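/- A map $\mathcal M$ is a 2-cell embedding of a finite connected graph in a compact connected surface without boundary. Its flags are the triangles of its barycentric subdivision; every flag $\Phi$ (a mutually incident vertex, edge and face) has a unique $i$-adjacent flag $\Phi\cdot s_i$, $i=0,1,2$, which shares with it the side opposite to the corner belonging to the vertex ($i=0$), the edge ($i=1$) or the face ($i=2$). The automorphisms of $\mathcal M$ are the permutations of its flags that commute with $s_0,s_1,s_2$, and $\mathcal M$ is a $k$-orbit map if its automorphism group has exactly $k$ orbits on the set of flags. $\mathcal M$ has type $\{4,4\}$ if every face is a 4-gon and every vertex has valency 4 (edges counted with multiplicity). The medial $Me(\mathcal M)$ is the map on the same surface whose vertices are the edges of $\mathcal M$, with one edge for each pair of consecutive edges around a corner (vertex–face incidence) of $\mathcal M$; its flags are $(\Phi,0),(\Phi,2)$ with $\Phi$ a flag of $\mathcal M$, and its adjacencies are $$(\Phi,j)\cdot S_0=(\Phi\cdot s_1,j),\quad (\Phi,0)\cdot S_1=(\Phi\cdot s_2,0),\quad (\Phi,2)\cdot S_1=(\Phi\cdot s_0,2),\quad (\Phi,j)\cdot S_2=(\Phi,2-j).$$ For integers $m,n\ge 1$,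 $\{4,4\}_{|m,n|}$ is the map on the Klein bottle obtained as the quotient of the tessellation of the plane by unit squares with vertex set $\mathbb Z^2$ by the group generated by the glide reflection $(x,y)\mapsto(x+m,-y)$ and the translation $(x,y)\mapsto(x,y+n)$. **Proposition.** Let $\mathcal M$ be a $k$-orbit map. If $\mathcal M$ is a map of type $\{4,4\}$ on the torus, or $\mathcal M$ is isomorphic to the map $\{4,4\}_{|m,n|}$ on the Klein bottle for some integers $m,n\ge1$ with $n$ odd, then $Me(Me(\mathcal M))$ is also a $k$-orbit map. -/

import Mathlib

universe u v

theorem perm_apply_inv {α : Type u} (a : Equiv.Perm α) (x : α) : a (a⁻¹ x) = x :=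
  a.apply_symm_apply x

/-- A map on a compact connected surface without boundary, given by its (finite) set of flags, i.e.
the triangles of its barycentric subdivision, and the distinguished generators `s 0`, `s 1`, `s 2`
of its monodromy group: `s i Φ` is the flag that is `i`-adjacent to `Φ`. -/
structure SurfaceMap where
  Flag : Type u
  finite_flag : Finite Flag
  nonempty_flag : Nonempty Flag
  s : Fin 3 → Equiv.Perm Flag
  s_invol : ∀ i Φ, s i (s i Φ) = Φ
  s_free : ∀ i Φ, s i Φ ≠ Φ
  s_comm : ∀ Φ, s 0 (s 2 Φ) = s 2 (s 0 Φ)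
  s_comm_free : ∀ Φ, s 0 (s 2 Φ) ≠ Φ
  s_transitive : ∀ Φ Ψ, ∃ w ∈ Subgroup.closure (Set.range s), w Φ = Ψ

namespace SurfaceMap

/-- The automorphism group: the permutations of the flags that commute with `s 0`, `s 1`, `s 2`. -/
def autGroup (M : SurfaceMap.{u}) : Subgroup (Equiv.Perm M.Flag) where
  carrier := {γ | ∀ i Φ, γ (M.s i Φ) = M.s i (γ Φ)}
  one_mem' := fun _ _ => rfl
  mul_mem' := by
    intro a b ha hb i Φ
    simp only [Equiv.Perm.mul_apply]
    rw [hb, ha]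
  inv_mem' := by
    intro a ha i Φ
    rw [Equiv.Perm.inv_eq_iff_eq, ha, perm_apply_inv]

/-- `M` is a `k`-orbit map: its automorphism group has exactly `k` orbits on flags. -/
def IsKOrbit (M : SurfaceMap.{u}) (k : ℕ) : Prop :=
  Nat.card (MulAction.orbitRel.Quotient M.autGroup M.Flag) = k

/-- The subgroup of the monodromy group generated by the two generators `s i`, `i ≠ j`. -/
def cellGroup (M : SurfaceMap.{u}) (j : Fin 3) : Subgroup (Equiv.Perm M.Flag) :=
  Subgroup.closure (M.s '' {i | i ≠ j})

/-- The `j`-faces of the map (vertices, edges, faces for `j = 0, 1, 2`). -/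
abbrev Cell (M : SurfaceMap.{u}) (j : Fin 3) : Type u :=
  MulAction.orbitRel.Quotient (M.cellGroup j) M.Flag

/-- The Euler characteristic `V - E + F` of the underlying surface. -/
noncomputable def eulerChar (M : SurfaceMap.{u}) : ℤ :=
  (Nat.card (M.Cell 0) : ℤ) - Nat.card (M.Cell 1) + Nat.card (M.Cell 2)

/-- The underlying surface is orientable: the flags can be coloured with two colours so that
adjacent flags have different colours. -/
def IsOrientable (M : SurfaceMap.{u}) : Prop :=
  ∃ c : M.Flag → Bool, ∀ i Φ, c (M.s i Φ) = !(c Φ)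

/-- The underlying surface is the torus. -/
def IsOnTorus (M : SurfaceMap.{u}) : Prop :=
  M.IsOrientable ∧ M.eulerChar = 0

/-- The map has Schläfli type `{p, q}`: every face is a `p`-gon (so it has `2 * p` flags) and every
vertex has valency `q` (so it has `2 * q` flags). Edges are counted with multiplicity. -/
def HasSchlafliType (M : SurfaceMap.{u}) (p q : ℕ) : Prop :=
  (∀ Φ : M.Flag, (MulAction.orbit (M.cellGroup 2) Φ).ncard = 2 * p) ∧
    (∀ Φ : M.Flag, (MulAction.orbit (M.cellGroup 0) Φ).ncard = 2 * q)

/-- Isomorphisms of maps. -/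
structure Iso (M : SurfaceMap.{u}) (N : SurfaceMap.{v}) where
  toEquiv : M.Flag ≃ N.Flag
  map_s : ∀ i Φ, toEquiv (M.s i Φ) = N.s i (toEquiv Φ)

/-! ### The medial map -/

/-- The generators of the monodromy group of the medial map. The flag `(Φ, false)` stands for
the flag `(edge, {vertex, face}, vertex)` of the medial that lies in the flag
`Φ = (vertex, edge, face)`, and `(Φ, true)` for `(edge, {vertex, face}, face)`. -/
def medialS (M : SurfaceMap.{u}) : Fin 3 → M.Flag × Bool → M.Flag × Bool
  | 0, (Φ, b) => (M.s 1 Φ, b)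
  | 1, (Φ, false) => (M.s 2 Φ, false)
  | 1, (Φ, true) => (M.s 0 Φ, true)
  | 2, (Φ, b) => (Φ, !b)

theorem medialS_invol (M : SurfaceMap.{u}) (i : Fin 3) : Function.Involutive (M.medialS i) := by
  rintro ⟨Φ, b⟩
  fin_cases i <;> cases b <;> simp [medialS, M.s_invol]

def medialPerm (M : SurfaceMap.{u}) (i : Fin 3) : Equiv.Perm (M.Flag × Bool) :=
  (M.medialS_invol i).toPerm

theorem medial_transitive (M : SurfaceMap.{u}) (X Y : M.Flag × Bool) :
    ∃ w ∈ Subgroup.closure (Set.range M.medialPerm), w X = Y := by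
  set H := Subgroup.closure (Set.range M.medialPerm)
  have hg : ∀ i, M.medialPerm i ∈ H := fun i => Subgroup.subset_closure ⟨i, rfl⟩
  have hstep : ∀ i Φ, ∃ W ∈ H, W (Φ, false) = (M.s i Φ, false) := by
    intro i Φ
    fin_cases i
    · exact ⟨M.medialPerm 2 * M.medialPerm 1 * M.medialPerm 2,
        H.mul_mem (H.mul_mem (hg 2) (hg 1)) (hg 2), rfl⟩
    · exact ⟨M.medialPerm 0, hg 0, rfl⟩
    · exact ⟨M.medialPerm 1, hg 1, rfl⟩
  have hwalk : ∀ w ∈ Subgroup.closure (Set.range M.s), ∀ Φ,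
      ∃ W ∈ H, W (Φ, false) = (w Φ, false) := by
    intro w hw
    induction hw using Subgroup.closure_induction with
    | mem x hx => obtain ⟨i, rfl⟩ := hx; exact hstep i
    | one => exact fun Φ => ⟨1, H.one_mem, rfl⟩
    | mul a b _ _ ha hb =>
      intro Φ
      obtain ⟨W, hW, h1⟩ := hb Φ
      obtain ⟨V, hV, h2⟩ := ha (b Φ)
      exact ⟨V * W, H.mul_mem hV hW, by rw [Equiv.Perm.mul_apply, h1, h2]; rfl⟩
    | inv a _ ha =>
      intro Φ
      obtain ⟨W, hW, h1⟩ := ha (a⁻¹ Φ)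
      refine ⟨W⁻¹, H.inv_mem hW, ?_⟩
      rw [Equiv.Perm.inv_eq_iff_eq, h1, perm_apply_inv]
  have hnorm : ∀ X : M.Flag × Bool, ∃ W ∈ H, W (X.1, false) = X := by
    rintro ⟨Φ, _ | _⟩
    · exact ⟨1, H.one_mem, rfl⟩
    · exact ⟨M.medialPerm 2, hg 2, rfl⟩
  obtain ⟨w, hw, h⟩ := M.s_transitive X.1 Y.1
  obtain ⟨W, hW, h1⟩ := hwalk w hw X.1
  obtain ⟨A, hA, h2⟩ := hnorm X
  obtain ⟨B, hB, h3⟩ := hnorm Y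
  refine ⟨B * W * A⁻¹, H.mul_mem (H.mul_mem hB hW) (H.inv_mem hA), ?_⟩
  have h4 : A⁻¹ X = (X.1, false) := by rw [Equiv.Perm.inv_eq_iff_eq, h2]
  rw [Equiv.Perm.mul_apply, Equiv.Perm.mul_apply, h4, h1, h, h3]

/-- The medial map `Me(M)`. -/
def medial (M : SurfaceMap.{u}) : SurfaceMap.{u} where
  Flag := M.Flag × Bool
  finite_flag := by
    have := M.finite_flag
    infer_instance
  nonempty_flag := by
    have := M.nonempty_flag
    infer_instance
  s := M.medialPerm
  s_invol := fun i => M.medialS_invol i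
  s_free := by
    rintro i ⟨Φ, b⟩
    fin_cases i <;> cases b <;> simp [medialPerm, medialS, M.s_free]
  s_comm := by
    rintro ⟨Φ, b⟩
    cases b <;> rfl
  s_comm_free := by
    rintro ⟨Φ, b⟩
    cases b <;> simp [medialPerm, medialS]
  s_transitive := M.medial_transitive

end SurfaceMap

/-! ### The square tessellation of the plane and the Klein bottle maps -/

/-- A flag of the tessellation of the plane by unit squares with vertex set `ℤ × ℤ`: the vertex
is `(x, y)`, the face is the unit square with opposite corners `(x, y)` and `(x + σ, y + τ)`,
and the edge joins `(x, y)` to `(x + σ, y)` if `horiz` is true and to `(x, y + τ)` otherwise. -/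
@[ext]
structure SquareFlag where
  x : ℤ
  y : ℤ
  horiz : Bool
  σ : ℤˣ
  τ : ℤˣ

namespace SquareFlag

/-- The `i`-adjacent flag in the square tessellation. -/
def adj : Fin 3 → SquareFlag → SquareFlag
  | 0, ⟨x, y, true, σ, τ⟩ => ⟨x + σ, y, true, -σ, τ⟩
  | 0, ⟨x, y, false, σ, τ⟩ => ⟨x, y + τ, false, σ, -τ⟩
  | 1, ⟨x, y, h, σ, τ⟩ => ⟨x, y, !h, σ, τ⟩
  | 2, ⟨x, y, true, σ, τ⟩ => ⟨x, y, true, σ, -τ⟩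
  | 2, ⟨x, y, false, σ, τ⟩ => ⟨x, y, false, -σ, τ⟩

/-- The action on flags of the glide reflection `(x, y) ↦ (x + m, -y)`. -/
def glide (m : ℤ) : Equiv.Perm SquareFlag where
  toFun Φ := ⟨Φ.x + m, -Φ.y, Φ.horiz, Φ.σ, -Φ.τ⟩
  invFun Φ := ⟨Φ.x - m, -Φ.y, Φ.horiz, Φ.σ, -Φ.τ⟩
  left_inv Φ := by ext <;> simp
  right_inv Φ := by ext <;> simp

/-- The action on flags of the translation `(x, y) ↦ (x, y + n)`. -/
def vtrans (n : ℤ) : Equiv.Perm SquareFlag where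
  toFun Φ := ⟨Φ.x, Φ.y + n, Φ.horiz, Φ.σ, Φ.τ⟩
  invFun Φ := ⟨Φ.x, Φ.y - n, Φ.horiz, Φ.σ, Φ.τ⟩
  left_inv Φ := by ext <;> simp
  right_inv Φ := by ext <;> simp

/-- The group generated by the glide reflection `(x, y) ↦ (x + m, -y)` and the translation
`(x, y) ↦ (x, y + n)`; the quotient of the plane by it is a Klein bottle. -/
def kleinGroup (m n : ℕ+) : Subgroup (Equiv.Perm SquareFlag) :=
  Subgroup.closure {glide m, vtrans n}

theorem adj_invol (i : Fin 3) : Function.Involutive (adj i) := by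
  rintro ⟨x, y, h, σ, τ⟩
  fin_cases i <;> cases h <;> simp [adj]

theorem kleinGroup_adj {m n : ℕ+} {g : Equiv.Perm SquareFlag} (hg : g ∈ kleinGroup m n) :
    ∀ (i : Fin 3) (Φ : SquareFlag), g (adj i Φ) = adj i (g Φ) := by
  induction hg using Subgroup.closure_induction with
  | mem a ha =>
    rintro i ⟨x, y, h, σ, τ⟩
    rcases ha with rfl | rfl <;> fin_cases i <;> cases h <;>
      simp [adj, glide, vtrans] <;> ring
  | one => exact fun _ _ => rfl
  | mul a b _ _ ha hb =>
    intro i Φ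
    rw [Equiv.Perm.mul_apply, hb, ha, Equiv.Perm.mul_apply]
  | inv a _ ha =>
    intro i Φ
    rw [Equiv.Perm.inv_eq_iff_eq, ha, perm_apply_inv]

theorem kleinGroup_form {m n : ℕ+} {g : Equiv.Perm SquareFlag} (hg : g ∈ kleinGroup m n) :
    ∃ i : ℤ, ∀ Φ : SquareFlag, (g Φ).x = Φ.x + i * m ∧ (g Φ).horiz = Φ.horiz ∧
      (g Φ).σ = Φ.σ ∧ (g Φ).τ = (-1) ^ i * Φ.τ := by
  induction hg using Subgroup.closure_induction with
  | mem a ha =>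
    rcases ha with rfl | rfl
    · exact ⟨1, fun Φ => by simp [glide]⟩
    · exact ⟨0, fun Φ => by simp [vtrans]⟩
  | one => exact ⟨0, fun Φ => by simp⟩
  | mul a b _ _ ha hb =>
    obtain ⟨i, hi⟩ := ha
    obtain ⟨j, hj⟩ := hb
    refine ⟨i + j, fun Φ => ?_⟩
    obtain ⟨h1, h2, h3, h4⟩ := hi (b Φ)
    obtain ⟨k1, k2, k3, k4⟩ := hj Φ
    rw [Equiv.Perm.mul_apply, h1, h2, h3, h4, k1, k2, k3, k4]
    refine ⟨by ring, rfl, rfl, by rw [zpow_add, mul_assoc]⟩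
  | inv a _ ha =>
    obtain ⟨i, hi⟩ := ha
    refine ⟨-i, fun Φ => ?_⟩
    obtain ⟨h1, h2, h3, h4⟩ := hi (a⁻¹ Φ)
    rw [perm_apply_inv] at h1 h2 h3 h4
    refine ⟨by rw [h1]; ring, h2.symm, h3.symm, ?_⟩
    rw [h4, ← mul_assoc, ← zpow_add, neg_add_cancel, zpow_zero, one_mul]

theorem unit_ne_neg (a : ℤˣ) : a ≠ -a := by
  intro h
  rcases Int.units_eq_one_or a with rfl | rfl <;> exact absurd h (by decide)

theorem kleinGroup_adj_ne {m n : ℕ+} {g : Equiv.Perm SquareFlag} (hg : g ∈ kleinGroup m n)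
    (i : Fin 3) (Φ : SquareFlag) : g Φ ≠ adj i Φ := by
  obtain ⟨j, hj⟩ := kleinGroup_form hg
  intro h
  obtain ⟨h1, h2, h3, h4⟩ := hj Φ
  rw [h] at h1 h2 h3 h4
  have hm : (m : ℤ) ≠ 0 := by exact_mod_cast m.ne_zero
  obtain ⟨x, y, b, σ, τ⟩ := Φ
  have hj0 : x = x + j * m → -τ = (-1) ^ j * τ → False := by
    intro e1 e2
    have hj1 : j = 0 := by simpa [hm] using e1
    rw [hj1, zpow_zero, one_mul] at e2
    exact unit_ne_neg τ e2.symm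
  fin_cases i <;> cases b
  · exact hj0 h1 h4
  · exact unit_ne_neg σ h3.symm
  · exact Bool.noConfusion h2
  · exact Bool.noConfusion h2
  · exact unit_ne_neg σ h3.symm
  · exact hj0 h1 h4

theorem kleinGroup_adj_adj_ne {m n : ℕ+} {g : Equiv.Perm SquareFlag} (hg : g ∈ kleinGroup m n)
    (Φ : SquareFlag) : g Φ ≠ adj 0 (adj 2 Φ) := by
  obtain ⟨j, hj⟩ := kleinGroup_form hg
  intro h
  obtain ⟨h1, h2, h3, h4⟩ := hj Φ
  rw [h] at h3
  obtain ⟨x, y, b, σ, τ⟩ := Φ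
  cases b <;> exact unit_ne_neg σ h3.symm

/-- Any two flags of the square tessellation are joined by a sequence of adjacent flags. -/
theorem reach (R : SquareFlag → Prop) (hR : ∀ i Φ, R (adj i Φ) ↔ R Φ) (Φ Ψ : SquareFlag)
    (h : R Φ) : R Ψ := by
  have hh : ∀ x y b σ τ, R ⟨x, y, b, σ, τ⟩ ↔ R ⟨x, y, true, σ, τ⟩ := by
    intro x y b σ τ
    cases b
    · exact hR 1 ⟨x, y, true, σ, τ⟩
    · rfl
  have hτ : ∀ x y b σ τ, R ⟨x, y, b, σ, τ⟩ ↔ R ⟨x, y, true, σ, 1⟩ := by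
    intro x y b σ τ
    rw [hh]
    rcases Int.units_eq_one_or τ with rfl | rfl
    · rfl
    · exact hR 2 ⟨x, y, true, σ, 1⟩
  have hσ : ∀ x y b σ τ, R ⟨x, y, b, σ, τ⟩ ↔ R ⟨x, y, true, 1, 1⟩ := by
    intro x y b σ τ
    rw [hτ]
    rcases Int.units_eq_one_or σ with rfl | rfl
    · rfl
    · rw [← hh x y false]
      exact (hR 2 ⟨x, y, false, 1, 1⟩).trans (hh _ _ _ _ _)
  have hx : ∀ x y, R ⟨x + 1, y, true, 1, 1⟩ ↔ R ⟨x, y, true, 1, 1⟩ := by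
    intro x y
    rw [← hσ (x + 1) y true (-1) 1]
    exact hR 0 ⟨x, y, true, 1, 1⟩
  have hy : ∀ x y, R ⟨x, y + 1, true, 1, 1⟩ ↔ R ⟨x, y, true, 1, 1⟩ := by
    intro x y
    rw [← hσ x (y + 1) false 1 (-1), ← hσ x y false 1 1]
    exact hR 0 ⟨x, y, false, 1, 1⟩
  have hx0 : ∀ x y, R ⟨x, y, true, 1, 1⟩ ↔ R ⟨0, y, true, 1, 1⟩ := by
    intro x y
    induction x using Int.induction_on with
    | zero => rfl
    | succ i ih => rw [hx, ih]
    | pred i ih => rw [← ih, ← hx, sub_add_cancel]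
  have hy0 : ∀ y, R ⟨0, y, true, 1, 1⟩ ↔ R ⟨0, 0, true, 1, 1⟩ := by
    intro y
    induction y using Int.induction_on with
    | zero => rfl
    | succ i ih => rw [hy, ih]
    | pred i ih => rw [← ih, ← hy, sub_add_cancel]
  have hall : ∀ Φ : SquareFlag, R Φ ↔ R ⟨0, 0, true, 1, 1⟩ := by
    rintro ⟨x, y, b, σ, τ⟩
    rw [hσ, hx0, hy0]
  rwa [hall, ← hall Φ]

/-- The flags of the quotient of the square tessellation by `kleinGroup m n`. -/
abbrev KleinFlag (m n : ℕ+) : Type :=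
  MulAction.orbitRel.Quotient (kleinGroup m n) SquareFlag

theorem kleinFlag_eq_iff {m n : ℕ+} {Φ Ψ : SquareFlag} :
    (Quotient.mk'' Φ : KleinFlag m n) = Quotient.mk'' Ψ ↔ ∃ g ∈ kleinGroup m n, g Ψ = Φ := by
  rw [Quotient.eq'', MulAction.orbitRel_apply, MulAction.mem_orbit_iff]
  constructor
  · rintro ⟨g, h⟩
    exact ⟨g, g.2, h⟩
  · rintro ⟨g, hg, h⟩
    exact ⟨⟨g, hg⟩, h⟩

/-- The adjacencies of the quotient. -/
def kleinAdj (m n : ℕ+) (i : Fin 3) : KleinFlag m n → KleinFlag m n :=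
  Quotient.map' (adj i) (by
    intro Φ Ψ h
    rw [MulAction.orbitRel_apply, MulAction.mem_orbit_iff] at h ⊢
    obtain ⟨g, rfl⟩ := h
    exact ⟨g, kleinGroup_adj g.2 i Ψ⟩)

theorem kleinAdj_invol (m n : ℕ+) (i : Fin 3) : Function.Involutive (kleinAdj m n i) := by
  intro q
  induction q using Quotient.inductionOn' with
  | h Φ => exact congrArg Quotient.mk'' (adj_invol i Φ)

def kleinPerm (m n : ℕ+) (i : Fin 3) : Equiv.Perm (KleinFlag m n) :=
  (kleinAdj_invol m n i).toPerm

theorem klein_transitive (m n : ℕ+) (p q : KleinFlag m n) :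
    ∃ w ∈ Subgroup.closure (Set.range (kleinPerm m n)), w p = q := by
  set H := Subgroup.closure (Set.range (kleinPerm m n))
  have hg : ∀ i, kleinPerm m n i ∈ H := fun i => Subgroup.subset_closure ⟨i, rfl⟩
  induction p using Quotient.inductionOn' with
  | h Φ =>
  induction q using Quotient.inductionOn' with
  | h Ψ =>
  refine reach (fun X => ∃ w ∈ H, w (Quotient.mk'' Φ) = Quotient.mk'' X) ?_ Φ Ψ
    ⟨1, H.one_mem, rfl⟩
  have key : ∀ i X, (∃ w ∈ H, w (Quotient.mk'' Φ) = Quotient.mk'' X) →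
      ∃ w ∈ H, w (Quotient.mk'' Φ) = Quotient.mk'' (adj i X) := by
    rintro i X ⟨w, hw, h⟩
    exact ⟨kleinPerm m n i * w, H.mul_mem (hg i) hw, by rw [Equiv.Perm.mul_apply, h]; rfl⟩
  intro i X
  refine ⟨fun h => ?_, key i X⟩
  have h1 := key i _ h
  rwa [adj_invol i X] at h1

theorem kleinFlag_finite (m n : ℕ+) : Finite (KleinFlag m n) := by
  let f : Fin m × Fin n × Bool × ℤˣ × ℤˣ → KleinFlag m n := fun t =>
    Quotient.mk'' ⟨(t.1 : ℕ), (t.2.1 : ℕ), t.2.2.1, t.2.2.2.1, t.2.2.2.2⟩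
  have hm : (0 : ℤ) < m := by exact_mod_cast m.pos
  have hn : (0 : ℤ) < n := by exact_mod_cast n.pos
  have hG : glide m ∈ kleinGroup m n := Subgroup.subset_closure (by simp)
  have hT : vtrans n ∈ kleinGroup m n := Subgroup.subset_closure (by simp)
  have hGz : ∀ (j : ℤ) (Φ : SquareFlag), ((glide m ^ j) Φ).x = Φ.x + j * m := by
    intro j
    induction j using Int.induction_on with
    | zero => simp
    | succ i ih =>
      intro Φ
      rw [zpow_add_one, Equiv.Perm.mul_apply, ih]
      simp only [glide, Equiv.coe_fn_mk]
      ring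
    | pred i ih =>
      intro Φ
      rw [zpow_sub_one, Equiv.Perm.mul_apply, ih]
      change Φ.x - m + _ = _
      ring
  have hTz : ∀ (j : ℤ) (Φ : SquareFlag),
      ((vtrans n ^ j) Φ).x = Φ.x ∧ ((vtrans n ^ j) Φ).y = Φ.y + j * n := by
    intro j
    induction j using Int.induction_on with
    | zero => simp
    | succ i ih =>
      intro Φ
      rw [zpow_add_one, Equiv.Perm.mul_apply, (ih _).1, (ih _).2]
      simp only [vtrans, Equiv.coe_fn_mk]
      exact ⟨trivial, by ring⟩
    | pred i ih =>
      intro Φ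
      rw [zpow_sub_one, Equiv.Perm.mul_apply, (ih _).1, (ih _).2]
      refine ⟨rfl, ?_⟩
      change Φ.y - n + _ = _
      ring
  refine Finite.of_surjective f ?_
  intro q
  induction q using Quotient.inductionOn' with
  | h Φ =>
  set Ψ := (glide m ^ (-(Φ.x / m))) Φ with hΨ
  set Ω := (vtrans n ^ (-(Ψ.y / n))) Ψ with hΩ
  have hx : Ω.x = Φ.x % m := by
    rw [hΩ, (hTz _ _).1, hΨ, hGz, Int.emod_def]
    ring
  have hy : Ω.y = Ψ.y % n := by
    rw [hΩ, (hTz _ _).2, Int.emod_def]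
    ring
  have hx0 : 0 ≤ Ω.x := hx ▸ Int.emod_nonneg _ hm.ne'
  have hy0 : 0 ≤ Ω.y := hy ▸ Int.emod_nonneg _ hn.ne'
  have hx1 : Ω.x < m := hx ▸ Int.emod_lt_of_pos _ hm
  have hy1 : Ω.y < n := hy ▸ Int.emod_lt_of_pos _ hn
  refine ⟨(⟨Ω.x.toNat, by omega⟩, ⟨Ω.y.toNat, by omega⟩, Ω.horiz, Ω.σ, Ω.τ), ?_⟩
  have hf : (⟨(Ω.x.toNat : ℤ), (Ω.y.toNat : ℤ), Ω.horiz, Ω.σ, Ω.τ⟩ : SquareFlag) = Ω := by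
    ext <;> simp [hx0, hy0]
  change (Quotient.mk'' (⟨(Ω.x.toNat : ℤ), (Ω.y.toNat : ℤ), Ω.horiz, Ω.σ, Ω.τ⟩ : SquareFlag) :
    KleinFlag m n) = _
  rw [hf, kleinFlag_eq_iff]
  exact ⟨vtrans n ^ (-(Ψ.y / n)) * glide m ^ (-(Φ.x / m)),
    Subgroup.mul_mem _ (Subgroup.zpow_mem _ hT _) (Subgroup.zpow_mem _ hG _), rfl⟩

end SquareFlag

/-- The Klein bottle map `{4,4}_{|m,n|}`: the quotient of the tessellation of the plane by unit
squares by the group generated by `(x, y) ↦ (x + m, -y)` and `(x, y) ↦ (x, y + n)`. -/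
def klein44 (m n : ℕ+) : SurfaceMap.{0} where
  Flag := SquareFlag.KleinFlag m n
  finite_flag := SquareFlag.kleinFlag_finite m n
  nonempty_flag := ⟨Quotient.mk'' ⟨0, 0, true, 1, 1⟩⟩
  s := SquareFlag.kleinPerm m n
  s_invol := fun i => SquareFlag.kleinAdj_invol m n i
  s_free := by
    intro i q
    induction q using Quotient.inductionOn' with
    | h Φ =>
      intro h
      obtain ⟨g, hg, hh⟩ := SquareFlag.kleinFlag_eq_iff.1 h
      exact SquareFlag.kleinGroup_adj_ne hg i Φ hh
  s_comm := by
    intro q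
    induction q using Quotient.inductionOn' with
    | h Φ =>
      refine congrArg Quotient.mk'' ?_
      obtain ⟨x, y, b, σ, τ⟩ := Φ
      cases b <;> rfl
  s_comm_free := by
    intro q
    induction q using Quotient.inductionOn' with
    | h Φ =>
      intro h
      obtain ⟨g, hg, hh⟩ := SquareFlag.kleinFlag_eq_iff.1 h
      exact SquareFlag.kleinGroup_adj_adj_ne hg Φ hh
  s_transitive := SquareFlag.klein_transitive m n

namespace SurfaceMap

/-! ### Orbits of a map and of its medial -/

/-! For a map of type {4,4}, `Me(Me(M))` is a square grid of half the mesh: its vertices lie in the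
corners of `M`, and its faces are centred at the vertices, edges and faces of `M`. Each flag `Φ`
splits into four flags `((Φ, a), b)`; `b = false` means that the face is centred at an edge of `M`,
and for `b = true` the bit `a` decides between a vertex and a face. Automorphisms of `M` lift, and
two flags `((Φ, false), false)` are equivalent exactly when their base flags are. So it suffices to
carry every flag into this class (`isKOrbit_medial_medial`).

This is done by shifts through an odd number of half edges of `M`, one horizontal and one vertical.
Both flip `b`; the horizontal one flips `a` on flags with horizontal edge, the vertical one on the
others (`isKOrbit_of_oddShift`).

Such a shift exists if left and right can be told apart consistently (`exists_shift`). It also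
exists if `n` unit steps close up with `n` odd: then `n` half steps forwards and backwards agree, so
no choice of direction is needed (`step_pow_mem_autGroup`).

On the torus, `M` is covered by the square tessellation. Orientability leaves only translations and
rotations as identifications, and rotations would fix a cell centre; hence both directions descend
(`translate_of_cover_eq`). On the Klein bottle the glide reflection preserves left and right but not
up and down; vertically the odd period `n` is used. -/

theorem forall_of_s_invariant (M : SurfaceMap.{u}) (R : M.Flag → Prop)
    (hR : ∀ i Φ, R Φ → R (M.s i Φ)) {Φ : M.Flag} (hΦ : R Φ) (Ψ : M.Flag) : R Ψ := by
  have key : ∀ w ∈ Subgroup.closure (Set.range M.s), ∀ X, R X ↔ R (w X) := by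
    intro w hw
    induction hw using Subgroup.closure_induction with
    | mem x hx =>
      obtain ⟨i, rfl⟩ := hx
      refine fun X => ⟨hR i X, fun h => ?_⟩
      simpa only [M.s_invol] using hR i _ h
    | one => exact fun _ => Iff.rfl
    | mul a b _ _ ha hb => exact fun X => (hb X).trans (ha (b X))
    | inv a _ ha =>
      intro X
      rw [ha (a⁻¹ X), perm_apply_inv]
  obtain ⟨w, hw, rfl⟩ := M.s_transitive Φ Ψ
  exact (key w hw Φ).1 hΦ

/-- Some automorphism of `M` maps `Φ` to `Ψ`. -/
def AutRel (M : SurfaceMap.{u}) (Φ Ψ : M.Flag) : Prop :=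
  ∃ γ ∈ M.autGroup, γ Φ = Ψ

theorem autRel_iff (M : SurfaceMap.{u}) {Φ Ψ : M.Flag} :
    (MulAction.orbitRel M.autGroup M.Flag) Ψ Φ ↔ M.AutRel Φ Ψ := by
  rw [MulAction.orbitRel_apply, MulAction.mem_orbit_iff]
  exact ⟨fun ⟨g, h⟩ => ⟨g, g.2, h⟩, fun ⟨g, hg, h⟩ => ⟨⟨g, hg⟩, h⟩⟩

theorem AutRel.trans {M : SurfaceMap.{u}} {Φ Ψ Ω : M.Flag} (h : M.AutRel Φ Ψ)
    (h' : M.AutRel Ψ Ω) : M.AutRel Φ Ω := by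
  obtain ⟨γ, hγ, rfl⟩ := h
  obtain ⟨δ, hδ, rfl⟩ := h'
  exact ⟨δ * γ, mul_mem hδ hγ, rfl⟩

/-- The flag `(Φ, b)` of the medial map. -/
def medialFlag (M : SurfaceMap.{u}) (Φ : M.Flag) (b : Bool) : M.medial.Flag := (Φ, b)

/-- The flag of `M` that contains a given flag of the medial map. -/
def baseFlag (M : SurfaceMap.{u}) (F : M.medial.Flag) : M.Flag := Prod.fst F

/-- The kind of a flag of the medial map: `false` if its face is a vertex of `M`, and `true` if it
is a face of `M`. -/
def kind (M : SurfaceMap.{u}) (F : M.medial.Flag) : Bool := Prod.snd F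

@[simp]
theorem baseFlag_medialFlag (M : SurfaceMap.{u}) (Φ : M.Flag) (b : Bool) :
    M.baseFlag (M.medialFlag Φ b) = Φ := rfl

@[simp]
theorem kind_medialFlag (M : SurfaceMap.{u}) (Φ : M.Flag) (b : Bool) :
    M.kind (M.medialFlag Φ b) = b := rfl

theorem medialFlag_surj (M : SurfaceMap.{u}) (F : M.medial.Flag) :
    ∃ Φ b, F = M.medialFlag Φ b := ⟨Prod.fst F, Prod.snd F, rfl⟩

@[simp]
theorem medial_s0 (M : SurfaceMap.{u}) (Φ : M.Flag) (b : Bool) :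
    M.medial.s 0 (M.medialFlag Φ b) = M.medialFlag (M.s 1 Φ) b := rfl

@[simp]
theorem medial_s1_false (M : SurfaceMap.{u}) (Φ : M.Flag) :
    M.medial.s 1 (M.medialFlag Φ false) = M.medialFlag (M.s 2 Φ) false := rfl

@[simp]
theorem medial_s1_true (M : SurfaceMap.{u}) (Φ : M.Flag) :
    M.medial.s 1 (M.medialFlag Φ true) = M.medialFlag (M.s 0 Φ) true := rfl

@[simp]
theorem medial_s2 (M : SurfaceMap.{u}) (Φ : M.Flag) (b : Bool) :
    M.medial.s 2 (M.medialFlag Φ b) = M.medialFlag Φ (!b) := rfl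

theorem autRel_medial (M : SurfaceMap.{u}) {Φ Ψ : M.Flag} (h : M.AutRel Φ Ψ) (b : Bool) :
    M.medial.AutRel (M.medialFlag Φ b) (M.medialFlag Ψ b) := by
  obtain ⟨γ, hγ, rfl⟩ := h
  let δ : Equiv.Perm M.medial.Flag := Equiv.prodCongr γ (Equiv.refl Bool)
  have hδ : ∀ X c, δ (M.medialFlag X c) = M.medialFlag (γ X) c := fun _ _ => rfl
  refine ⟨δ, ?_, rfl⟩
  intro i F
  obtain ⟨X, c, rfl⟩ := M.medialFlag_surj F
  fin_cases i <;> cases c <;> simp [hδ, hγ _ _]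

/-- On flags of kind `false` the generators `s 0`, `s 1`, `s 2` of `M` are the words `S₂S₁S₂`, `S₀`,
`S₁` of the medial. An automorphism that keeps one such flag in its kind therefore keeps all of
them, and restricts to `M`. -/
theorem autRel_of_medial (M : SurfaceMap.{u}) {Φ Ψ : M.Flag}
    (h : M.medial.AutRel (M.medialFlag Φ false) (M.medialFlag Ψ false)) : M.AutRel Φ Ψ := by
  obtain ⟨γ, hγ, h⟩ := h
  have hs : ∀ i X Y, γ (M.medialFlag X false) = M.medialFlag Y false →
      γ (M.medialFlag (M.s i X) false) = M.medialFlag (M.s i Y) false := by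
    intro i X Y hX
    fin_cases i
    · have e : M.medialFlag (M.s 0 X) false =
          M.medial.s 2 (M.medial.s 1 (M.medial.s 2 (M.medialFlag X false))) := by simp
      simp only [Fin.zero_eta]
      rw [e, hγ, hγ, hγ, hX]
      simp
    · have e : M.medialFlag (M.s 1 X) false = M.medial.s 0 (M.medialFlag X false) := by simp
      simp only [Fin.mk_one]
      rw [e, hγ, hX, medial_s0]
    · have e : M.medialFlag (M.s 2 X) false = M.medial.s 1 (M.medialFlag X false) := by simp
      simp only [Fin.reduceFinMk]
      rw [e, hγ, hX, medial_s1_false]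
  have hall : ∀ X, ∃ Y, γ (M.medialFlag X false) = M.medialFlag Y false :=
    M.forall_of_s_invariant _ (fun i X ⟨Y, hY⟩ => ⟨_, hs i X Y hY⟩) ⟨Ψ, h⟩
  choose f hf using hall
  have := M.finite_flag
  have hinj : Function.Injective f := by
    intro X Y hXY
    have := γ.injective ((hf X).trans ((congrArg (M.medialFlag · false) hXY).trans (hf Y).symm))
    exact congrArg M.baseFlag this
  refine ⟨Equiv.ofBijective f (Finite.injective_iff_bijective.1 hinj), ?_, ?_⟩
  · intro i X
    exact congrArg M.baseFlag ((hf _).symm.trans (hs i X _ (hf X)))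
  · exact congrArg M.baseFlag ((hf _).symm.trans h)

/-- The flag `((Φ, a), b)` of the medial of the medial. -/
def medialFlag₂ (M : SurfaceMap.{u}) (Φ : M.Flag) (a b : Bool) : M.medial.medial.Flag :=
  M.medial.medialFlag (M.medialFlag Φ a) b

/-- If every flag of the medial of the medial is equivalent to one of the form
`((Ψ, false), false)`, then taking the medial twice preserves the number of flag orbits. -/
theorem isKOrbit_medial_medial (M : SurfaceMap.{u}) (k : ℕ) (hk : M.IsKOrbit k)
    (h : ∀ F : M.medial.medial.Flag, ∃ Ψ : M.Flag,
      M.medial.medial.AutRel F (M.medialFlag₂ Ψ false false)) : M.medial.medial.IsKOrbit k := by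
  rw [IsKOrbit, ← hk]
  let f : MulAction.orbitRel.Quotient M.autGroup M.Flag →
      MulAction.orbitRel.Quotient M.medial.medial.autGroup M.medial.medial.Flag :=
    Quotient.map' (fun Φ => M.medialFlag₂ Φ false false) (by
      intro Φ Ψ hΦ
      exact (autRel_iff _).2
        (M.medial.autRel_medial (M.autRel_medial ((autRel_iff _).1 hΦ) false) false))
  refine (Nat.card_eq_of_bijective f ⟨?_, ?_⟩).symm
  · intro p q
    induction p using Quotient.inductionOn' with
    | h Φ =>
    induction q using Quotient.inductionOn' with
    | h Ψ =>
    intro hpq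
    have h1 := (autRel_iff _).1 (Quotient.eq''.1 hpq)
    exact Quotient.eq''.2 ((autRel_iff _).2 (M.autRel_of_medial (M.medial.autRel_of_medial h1)))
  · intro q
    induction q using Quotient.inductionOn' with
    | h F =>
    obtain ⟨Ψ, hΨ⟩ := h F
    exact ⟨Quotient.mk'' Ψ, Quotient.eq''.2 ((autRel_iff _).2 hΨ)⟩

/-! ### Unit steps in maps of type `{4,4}` -/

/-- The relations of the Coxeter group `[4,4]` in the monodromy group. -/
structure IsSquare (M : SurfaceMap.{u}) : Prop where
  face : ∀ Φ, M.s 0 (M.s 1 (M.s 0 (M.s 1 Φ))) = M.s 1 (M.s 0 (M.s 1 (M.s 0 Φ)))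
  vertex : ∀ Φ, M.s 2 (M.s 1 (M.s 2 (M.s 1 Φ))) = M.s 1 (M.s 2 (M.s 1 (M.s 2 Φ)))

/-- `h` tells the edges of one parallel class ("horizontal") from those of the other one. -/
structure IsParallel (M : SurfaceMap.{u}) (h : M.Flag → Bool) : Prop where
  s0 : ∀ Φ, h (M.s 0 Φ) = h Φ
  s1 : ∀ Φ, h (M.s 1 Φ) = !(h Φ)
  s2 : ∀ Φ, h (M.s 2 Φ) = h Φ

/-- `d Φ` is the direction (left or right) from the vertex of `Φ` to the centre of its face. -/
structure IsDirection (M : SurfaceMap.{u}) (h d : M.Flag → Bool) : Prop where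
  s0 : ∀ Φ, d (M.s 0 Φ) = xor (d Φ) (h Φ)
  s1 : ∀ Φ, d (M.s 1 Φ) = d Φ
  s2 : ∀ Φ, d (M.s 2 Φ) = xor (d Φ) (!(h Φ))

theorem IsParallel.not {M : SurfaceMap.{u}} {h : M.Flag → Bool} (hh : M.IsParallel h) :
    M.IsParallel fun Φ => !(h Φ) :=
  ⟨fun Φ => by rw [hh.s0], fun Φ => by rw [hh.s1], fun Φ => by rw [hh.s2]⟩

/-- Move a flag by one step along the horizontal line, away from its vertex. -/
def stepFun (M : SurfaceMap.{u}) (h : M.Flag → Bool) (Φ : M.Flag) : M.Flag :=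
  if h Φ then M.s 1 (M.s 2 (M.s 1 (M.s 0 Φ))) else M.s 2 (M.s 1 (M.s 0 (M.s 1 Φ)))

/-- The inverse of `stepFun`. -/
def stepInv (M : SurfaceMap.{u}) (h : M.Flag → Bool) (Φ : M.Flag) : M.Flag :=
  if h Φ then M.s 0 (M.s 1 (M.s 2 (M.s 1 Φ))) else M.s 1 (M.s 0 (M.s 1 (M.s 2 Φ)))

/-- `stepFun` as a permutation. -/
def step (M : SurfaceMap.{u}) {h : M.Flag → Bool} (hh : M.IsParallel h) :
    Equiv.Perm M.Flag where
  toFun := M.stepFun h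
  invFun := M.stepInv h
  left_inv Φ := by
    cases e : h Φ <;> simp [stepFun, stepInv, e, hh.s0, hh.s1, hh.s2, M.s_invol]
  right_inv Φ := by
    cases e : h Φ <;> simp [stepFun, stepInv, e, hh.s0, hh.s1, hh.s2, M.s_invol]

/-! ### Unit steps as automorphisms -/

section step

variable {M : SurfaceMap.{u}} {h : M.Flag → Bool} (hh : M.IsParallel h)

theorem step_of_true {Φ : M.Flag} (e : h Φ = true) :
    M.step hh Φ = M.s 1 (M.s 2 (M.s 1 (M.s 0 Φ))) := by
  simp [step, stepFun, e]

theorem step_of_false {Φ : M.Flag} (e : h Φ = false) :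
    M.step hh Φ = M.s 2 (M.s 1 (M.s 0 (M.s 1 Φ))) := by
  simp [step, stepFun, e]

theorem step_inv_of_true {Φ : M.Flag} (e : h Φ = true) :
    (M.step hh)⁻¹ Φ = M.s 0 (M.s 1 (M.s 2 (M.s 1 Φ))) := by
  change M.stepInv h Φ = _
  simp [stepInv, e]

theorem step_inv_of_false {Φ : M.Flag} (e : h Φ = false) :
    (M.step hh)⁻¹ Φ = M.s 1 (M.s 0 (M.s 1 (M.s 2 Φ))) := by
  change M.stepInv h Φ = _
  simp [stepInv, e]

theorem parallel_step (Φ : M.Flag) : h (M.step hh Φ) = h Φ := by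
  cases e : h Φ
  · rw [step_of_false hh e]; simp [hh.s0, hh.s1, hh.s2, e]
  · rw [step_of_true hh e]; simp [hh.s0, hh.s1, hh.s2, e]

theorem parallel_step_inv (Φ : M.Flag) : h ((M.step hh)⁻¹ Φ) = h Φ := by
  conv_rhs => rw [← perm_apply_inv (M.step hh) Φ, parallel_step hh]

theorem parallel_step_pow (n : ℕ) (Φ : M.Flag) : h ((M.step hh ^ n) Φ) = h Φ := by
  induction n with
  | zero => rfl
  | succ n ih => rw [pow_succ', Equiv.Perm.mul_apply, parallel_step hh, ih]

theorem step_s1 (Φ : M.Flag) : M.step hh (M.s 1 Φ) = M.s 1 (M.step hh Φ) := by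
  cases e : h Φ
  · rw [step_of_false hh e, step_of_true hh (by rw [hh.s1, e]; rfl)]
  · rw [step_of_true hh e, step_of_false hh (by rw [hh.s1, e]; rfl), M.s_invol, M.s_invol]

/-- Steps point away from the vertex of the flag. Here, and in `step_s2_of_false`, the adjacency is
a left-right reflection, so it inverts the step; in the other cases it commutes with the step. -/
theorem step_s0_of_true {Φ : M.Flag} (e : h Φ = true) :
    M.step hh (M.s 0 Φ) = M.s 0 ((M.step hh)⁻¹ Φ) := by
  rw [step_of_true hh (by rw [hh.s0, e]), step_inv_of_true hh e, M.s_invol, M.s_invol]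

theorem step_s0_of_false (hM : M.IsSquare) {Φ : M.Flag} (e : h Φ = false) :
    M.step hh (M.s 0 Φ) = M.s 0 (M.step hh Φ) := by
  rw [step_of_false hh (by rw [hh.s0, e]), step_of_false hh e, M.s_comm, hM.face]

theorem step_s2_of_true (hM : M.IsSquare) {Φ : M.Flag} (e : h Φ = true) :
    M.step hh (M.s 2 Φ) = M.s 2 (M.step hh Φ) := by
  rw [step_of_true hh (by rw [hh.s2, e]), step_of_true hh e, M.s_comm, hM.vertex]

theorem step_s2_of_false {Φ : M.Flag} (e : h Φ = false) :
    M.step hh (M.s 2 Φ) = M.s 2 ((M.step hh)⁻¹ Φ) := by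
  rw [step_of_false hh (by rw [hh.s2, e]), step_inv_of_false hh e]

theorem direction_step {d : M.Flag → Bool} (hd : M.IsDirection h d) (Φ : M.Flag) :
    d (M.step hh Φ) = d Φ := by
  cases e : h Φ
  · rw [step_of_false hh e]; simp [hh.s0, hh.s1, hd.s0, hd.s1, hd.s2, e]
  · rw [step_of_true hh e]; simp [hh.s0, hh.s1, hd.s0, hd.s1, hd.s2, e]

theorem direction_step_inv {d : M.Flag → Bool} (hd : M.IsDirection h d) (Φ : M.Flag) :
    d ((M.step hh)⁻¹ Φ) = d Φ := by
  conv_rhs => rw [← perm_apply_inv (M.step hh) Φ, direction_step hh hd]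

theorem step_inv_comm {i : Fin 3} {Φ : M.Flag}
    (e : M.step hh (M.s i ((M.step hh)⁻¹ Φ)) = M.s i (M.step hh ((M.step hh)⁻¹ Φ))) :
    (M.step hh)⁻¹ (M.s i Φ) = M.s i ((M.step hh)⁻¹ Φ) := by
  rw [Equiv.Perm.inv_eq_iff_eq, e, perm_apply_inv]

theorem step_inv_swap {i : Fin 3} {Φ : M.Flag}
    (e : M.step hh (M.s i (M.step hh Φ)) = M.s i ((M.step hh)⁻¹ (M.step hh Φ))) :
    (M.step hh)⁻¹ (M.s i Φ) = M.s i (M.step hh Φ) := by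
  rw [Equiv.Perm.inv_eq_iff_eq, e, show (M.step hh)⁻¹ (M.step hh Φ) = Φ from (M.step hh).symm_apply_apply Φ]

/-- Flags pointing left and right step opposite ways. Inverting the step on one of the two classes
makes all flags move the same way, which is a translation. -/
theorem exists_shift (hM : M.IsSquare) {d : M.Flag → Bool} (hd : M.IsDirection h d) :
    ∃ γ ∈ M.autGroup, ∀ Φ, γ Φ = M.step hh Φ ∨ γ Φ = (M.step hh)⁻¹ Φ := by
  let γ : Equiv.Perm M.Flag :=
    { toFun := fun Φ => if d Φ then M.step hh Φ else (M.step hh)⁻¹ Φ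
      invFun := fun Φ => if d Φ then (M.step hh)⁻¹ Φ else M.step hh Φ
      left_inv := fun Φ => by
        have e₁ := direction_step hh hd Φ
        have e₂ := direction_step_inv hh hd Φ
        cases e : d Φ
        · simp only [e, Bool.false_eq_true, if_false, e₂]
          exact perm_apply_inv _ _
        · simp only [e, if_true, e₁]
          exact (M.step hh).symm_apply_apply Φ
      right_inv := fun Φ => by
        have e₁ := direction_step hh hd Φ
        have e₂ := direction_step_inv hh hd Φ
        cases e : d Φ
        · simp only [e, Bool.false_eq_true, if_false, e₁]
          exact (M.step hh).symm_apply_apply Φ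
        · simp only [e, if_true, e₂]
          exact perm_apply_inv _ _ }
  have ht : ∀ {Φ}, d Φ = true → γ Φ = M.step hh Φ := fun e => if_pos e
  have hf : ∀ {Φ}, d Φ = false → γ Φ = (M.step hh)⁻¹ Φ := fun e => by simp [γ, e]
  have h0 : ∀ Φ, γ (M.s 0 Φ) = M.s 0 (γ Φ) := by
    intro Φ
    cases e : d Φ <;> cases e' : h Φ
    · rw [hf e, hf (by rw [hd.s0, e, e']; rfl)]
      exact step_inv_comm hh (step_s0_of_false hh hM (by rw [parallel_step_inv hh, e']))
    · rw [hf e, ht (by rw [hd.s0, e, e']; rfl), step_s0_of_true hh e']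
    · rw [ht e, ht (by rw [hd.s0, e, e']; rfl), step_s0_of_false hh hM e']
    · rw [ht e, hf (by rw [hd.s0, e, e']; rfl)]
      exact step_inv_swap hh (step_s0_of_true hh (by rw [parallel_step hh, e']))
  have h1 : ∀ Φ, γ (M.s 1 Φ) = M.s 1 (γ Φ) := by
    intro Φ
    cases e : d Φ
    · rw [hf e, hf (by rw [hd.s1, e])]
      exact step_inv_comm hh (step_s1 hh _)
    · rw [ht e, ht (by rw [hd.s1, e]), step_s1]
  have h2 : ∀ Φ, γ (M.s 2 Φ) = M.s 2 (γ Φ) := by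
    intro Φ
    cases e : d Φ <;> cases e' : h Φ
    · rw [hf e, ht (by rw [hd.s2, e, e']; rfl), step_s2_of_false hh e']
    · rw [hf e, hf (by rw [hd.s2, e, e']; rfl)]
      exact step_inv_comm hh (step_s2_of_true hh hM (by rw [parallel_step_inv hh, e']))
    · rw [ht e, hf (by rw [hd.s2, e, e']; rfl)]
      exact step_inv_swap hh (step_s2_of_false hh (by rw [parallel_step hh, e']))
    · rw [ht e, ht (by rw [hd.s2, e, e']; rfl), step_s2_of_true hh hM e']
  refine ⟨γ, ?_, fun Φ => ?_⟩
  · intro i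
    fin_cases i
    exacts [h0, h1, h2]
  · cases e : d Φ
    exacts [Or.inr (hf e), Or.inl (ht e)]

theorem step_pow_comm (n : ℕ) (i : Fin 3) (b : Bool)
    (e : ∀ Φ, h Φ = b → M.step hh (M.s i Φ) = M.s i (M.step hh Φ)) {Φ : M.Flag} (hΦ : h Φ = b) :
    (M.step hh ^ n) (M.s i Φ) = M.s i ((M.step hh ^ n) Φ) := by
  induction n with
  | zero => rfl
  | succ n ih =>
    rw [pow_succ', Equiv.Perm.mul_apply, Equiv.Perm.mul_apply, ih,
      e _ (by rw [parallel_step_pow hh, hΦ])]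

theorem step_pow_swap (n : ℕ) (i : Fin 3) (b : Bool)
    (e : ∀ Φ, h Φ = b → M.step hh (M.s i Φ) = M.s i ((M.step hh)⁻¹ Φ)) (Φ : M.Flag)
    (hΦ : h Φ = b) :
    (M.step hh ^ n) (M.s i Φ) = M.s i (((M.step hh)⁻¹ ^ n) Φ) := by
  induction n generalizing Φ with
  | zero => rfl
  | succ n ih =>
    rw [pow_succ, Equiv.Perm.mul_apply, e _ hΦ, ih _ (by rw [parallel_step_inv hh, hΦ]), pow_succ,
      Equiv.Perm.mul_apply]

/-- If `2 * n` steps lead back, then `n` steps in either direction are an automorphism. -/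
theorem step_pow_mem_autGroup (hM : M.IsSquare) {n : ℕ} (hn : M.step hh ^ (2 * n) = 1) :
    M.step hh ^ n ∈ M.autGroup := by
  have hinv : (M.step hh)⁻¹ ^ n = M.step hh ^ n := by
    rw [inv_pow, inv_eq_iff_mul_eq_one, ← pow_add, ← two_mul, hn]
  have h0 : ∀ Φ, (M.step hh ^ n) (M.s 0 Φ) = M.s 0 ((M.step hh ^ n) Φ) := by
    intro Φ
    cases e : h Φ
    · exact step_pow_comm hh n 0 false (fun _ => step_s0_of_false hh hM) e
    · rw [step_pow_swap hh n 0 true (fun _ => step_s0_of_true hh) Φ e, hinv]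
  have h1 : ∀ Φ, (M.step hh ^ n) (M.s 1 Φ) = M.s 1 ((M.step hh ^ n) Φ) := fun Φ =>
    step_pow_comm hh n 1 (h Φ) (fun Ψ _ => step_s1 hh Ψ) rfl
  have h2 : ∀ Φ, (M.step hh ^ n) (M.s 2 Φ) = M.s 2 ((M.step hh ^ n) Φ) := by
    intro Φ
    cases e : h Φ
    · rw [step_pow_swap hh n 2 false (fun _ => step_s2_of_false hh) Φ e, hinv]
    · exact step_pow_comm hh n 2 true (fun _ => step_s2_of_true hh hM) e
  intro i
  fin_cases i
  exacts [h0, h1, h2]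

end step
end SurfaceMap

namespace SurfaceMap

/-! ### The medial of the medial of a map of type `{4,4}` -/

/-- Faces of the medial are the vertices and faces of `M`, and supply the face relation; its
vertices are the edges of `M`, where `s 0` and `s 2` commute. -/
theorem IsSquare.medial {M : SurfaceMap.{u}} (hM : M.IsSquare) : M.medial.IsSquare := by
  constructor <;> intro F <;> obtain ⟨Φ, b, rfl⟩ := M.medialFlag_surj F <;> cases b
  · simp [hM.vertex]
  · simp [hM.face]
  · simp [M.s_comm]
  · simp [M.s_comm]

theorem medialFlag₂_surj (M : SurfaceMap.{u}) (F : M.medial.medial.Flag) :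
    ∃ Φ a b, F = M.medialFlag₂ Φ a b := by
  obtain ⟨G, b, rfl⟩ := M.medial.medialFlag_surj F
  obtain ⟨Φ, a, rfl⟩ := M.medialFlag_surj G
  exact ⟨Φ, a, b, rfl⟩

/-- The parallel classes of edges of `Me(Me(M))`. -/
def liftParallel (M : SurfaceMap.{u}) (h : M.Flag → Bool) (F : M.medial.medial.Flag) : Bool :=
  xor (h (M.baseFlag (M.medial.baseFlag F))) !(M.kind (M.medial.baseFlag F))

/-- The directions of the flags of `Me(Me(M))`. -/
def liftDirection (M : SurfaceMap.{u}) (h d : M.Flag → Bool) (F : M.medial.medial.Flag) : Bool :=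
  let Φ := M.baseFlag (M.medial.baseFlag F)
  xor (d Φ) !(bif M.medial.kind F then M.kind (M.medial.baseFlag F) else h Φ)

/-- An edge of `Me(Me(M))` is perpendicular to the segment from the midpoint of an edge of `M` to
its vertex (kind `false`) or face (kind `true`). Hence it is parallel to the edge of `M` exactly for
kind `true`. -/
theorem IsParallel.lift {M : SurfaceMap.{u}} {h : M.Flag → Bool} (hh : M.IsParallel h) :
    M.medial.medial.IsParallel (M.liftParallel h) := by
  constructor <;> intro F <;> obtain ⟨Φ, a, b, rfl⟩ := M.medialFlag₂_surj F <;>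
    cases a <;> cases b <;> simp [medialFlag₂, liftParallel, hh.s0, hh.s1, hh.s2]

/-- The vertex of the small flag is a quarter unit inside the corner of `M`. From there, the centre
of a face or the midpoint of a horizontal edge of `M` lies in direction `d`; a vertex or the
midpoint of a vertical edge lies the opposite way. -/
theorem IsDirection.lift {M : SurfaceMap.{u}} {h d : M.Flag → Bool} (hh : M.IsParallel h)
    (hd : M.IsDirection h d) :
    M.medial.medial.IsDirection (M.liftParallel h) (M.liftDirection h d) := by
  constructor <;> intro F <;> obtain ⟨Φ, a, b, rfl⟩ := M.medialFlag₂_surj F <;>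
    cases a <;> cases b <;> cases e : h Φ <;>
    simp [medialFlag₂, liftParallel, liftDirection, hh.s0, hh.s1, hh.s2, hd.s0, hd.s1, hd.s2, e]

theorem liftParallel_not (M : SurfaceMap.{u}) (h : M.Flag → Bool) :
    M.liftParallel (fun Φ => !(h Φ)) = fun F => !(M.liftParallel h F) := by
  funext F
  simp [liftParallel]

theorem lift_step_kind {M : SurfaceMap.{u}} {h : M.Flag → Bool} (hh : M.IsParallel h)
    (F : M.medial.medial.Flag) :
    M.medial.kind (M.medial.medial.step hh.lift F) = !(M.medial.kind F) := by
  obtain ⟨Φ, a, b, rfl⟩ := M.medialFlag₂_surj F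
  cases e : M.liftParallel h (M.medialFlag₂ Φ a b)
  · rw [step_of_false _ e]
    cases a <;> cases b <;> simp [medialFlag₂]
  · rw [step_of_true _ e]
    cases a <;> cases b <;> simp [medialFlag₂]

theorem lift_step_kind_base {M : SurfaceMap.{u}} {h : M.Flag → Bool} (hh : M.IsParallel h)
    (F : M.medial.medial.Flag) :
    M.kind (M.medial.baseFlag (M.medial.medial.step hh.lift F)) =
      xor (M.kind (M.medial.baseFlag F)) (M.liftParallel h F) := by
  obtain ⟨Φ, a, b, rfl⟩ := M.medialFlag₂_surj F
  cases e : M.liftParallel h (M.medialFlag₂ Φ a b)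
  · rw [step_of_false _ e]
    cases a <;> cases b <;> simp [medialFlag₂]
  · rw [step_of_true _ e]
    cases a <;> cases b <;> simp [medialFlag₂]

/-- Two half steps make a unit step of `M`, forwards or backwards according to the sign that occurs
in `liftDirection`. -/
theorem lift_step_sq {M : SurfaceMap.{u}} {h : M.Flag → Bool} (hh : M.IsParallel h)
    (Φ : M.Flag) (a b : Bool) :
    M.medial.medial.step hh.lift (M.medial.medial.step hh.lift (M.medialFlag₂ Φ a b)) =
      M.medialFlag₂ (bif (bif b then a else h Φ) then M.step hh Φ else (M.step hh)⁻¹ Φ) a b := by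
  have hl := parallel_step hh.lift (M.medialFlag₂ Φ a b)
  cases e : h Φ <;> cases a
  · have e' : ∀ b, M.liftParallel h (M.medialFlag₂ Φ false b) = true := fun b => by
      simp [liftParallel, medialFlag₂, e]
    rw [step_of_true _ (hl.trans (e' _)), step_of_true _ (e' _), step_inv_of_false _ e]
    cases b <;> simp [medialFlag₂]
  · have e' : ∀ b, M.liftParallel h (M.medialFlag₂ Φ true b) = false := fun b => by
      simp [liftParallel, medialFlag₂, e]
    rw [step_of_false _ (hl.trans (e' _)), step_of_false _ (e' _), step_inv_of_false _ e,
      step_of_false _ e]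
    cases b <;> simp [medialFlag₂]
  · have e' : ∀ b, M.liftParallel h (M.medialFlag₂ Φ false b) = false := fun b => by
      simp [liftParallel, medialFlag₂, e]
    rw [step_of_false _ (hl.trans (e' _)), step_of_false _ (e' _), step_inv_of_true _ e,
      step_of_true _ e]
    cases b <;> simp [medialFlag₂]
  · have e' : ∀ b, M.liftParallel h (M.medialFlag₂ Φ true b) = true := fun b => by
      simp [liftParallel, medialFlag₂, e]
    rw [step_of_true _ (hl.trans (e' _)), step_of_true _ (e' _), step_of_true _ e]
    cases b <;> simp [medialFlag₂]

theorem lift_step_pow {M : SurfaceMap.{u}} {h : M.Flag → Bool} (hh : M.IsParallel h)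
    {n : ℕ} (hn : M.step hh ^ n = 1) :
    M.medial.medial.step hh.lift ^ (2 * n) = 1 := by
  have key : ∀ (m : ℕ) (Φ : M.Flag) (a b : Bool),
      (M.medial.medial.step hh.lift ^ (2 * m)) (M.medialFlag₂ Φ a b) =
        M.medialFlag₂ (bif (bif b then a else h Φ) then (M.step hh ^ m) Φ
          else ((M.step hh)⁻¹ ^ m) Φ) a b := by
    intro m
    induction m with
    | zero => intro Φ a b; simp
    | succ m ih =>
      intro Φ a b
      -- The sign depends only on `a`, `b` and `h`, so it stays constant along the iteration.
      have e : (bif b then a else h (bif (bif b then a else h Φ) then M.step hh Φ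
          else (M.step hh)⁻¹ Φ)) = (bif b then a else h Φ) := by
        cases b
        · cases e : h Φ
          · exact (parallel_step_inv hh Φ).trans e
          · exact (parallel_step hh Φ).trans e
        · rfl
      rw [mul_add, mul_one, pow_add, pow_two, Equiv.Perm.mul_apply, Equiv.Perm.mul_apply,
        lift_step_sq hh, ih, e, pow_succ, pow_succ]
      cases (bif b then a else h Φ) <;> rfl
  ext F
  obtain ⟨Φ, a, b, rfl⟩ := M.medialFlag₂_surj F
  rw [key, inv_pow, hn, inv_one]
  simp

/-- `γ` shifts every flag of `Me(Me(M))` by an odd number of steps. -/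
def IsOddShift (M : SurfaceMap.{u}) (h : M.Flag → Bool)
    (γ : Equiv.Perm M.medial.medial.Flag) : Prop :=
  ∀ F, M.medial.kind (γ F) = !(M.medial.kind F) ∧ M.liftParallel h (γ F) = M.liftParallel h F ∧
    M.kind (M.medial.baseFlag (γ F)) = xor (M.kind (M.medial.baseFlag F)) (M.liftParallel h F)

theorem isOddShift_step {M : SurfaceMap.{u}} {h : M.Flag → Bool} (hh : M.IsParallel h) :
    M.IsOddShift h (M.medial.medial.step hh.lift) := fun F =>
  ⟨lift_step_kind hh F, parallel_step hh.lift F, lift_step_kind_base hh F⟩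

theorem isOddShift_step_inv {M : SurfaceMap.{u}} {h : M.Flag → Bool} (hh : M.IsParallel h) :
    M.IsOddShift h (M.medial.medial.step hh.lift)⁻¹ := by
  intro F
  obtain ⟨h1, h2, h3⟩ := isOddShift_step hh ((M.medial.medial.step hh.lift)⁻¹ F)
  rw [perm_apply_inv] at h1 h2 h3
  rw [h1, h2, h3]
  simp

theorem IsOddShift.pow {M : SurfaceMap.{u}} {h : M.Flag → Bool}
    {γ : Equiv.Perm M.medial.medial.Flag} (hγ : M.IsOddShift h γ) {n : ℕ} (hn : Odd n) :
    M.IsOddShift h (γ ^ n) := by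
  obtain ⟨m, rfl⟩ := hn
  induction m with
  | zero => simpa using hγ
  | succ m ih =>
    intro F
    rw [show 2 * (m + 1) + 1 = 2 + (2 * m + 1) by ring, pow_add, pow_two, Equiv.Perm.mul_apply,
      Equiv.Perm.mul_apply]
    obtain ⟨h1, h2, h3⟩ := ih F
    obtain ⟨k1, k2, k3⟩ := hγ ((γ ^ (2 * m + 1)) F)
    obtain ⟨l1, l2, l3⟩ := hγ (γ ((γ ^ (2 * m + 1)) F))
    rw [l1, l2, l3, k1, k2, k3, h1, h2, h3]
    simp

theorem exists_oddShift_of_direction {M : SurfaceMap.{u}} (hM : M.IsSquare) {h d : M.Flag → Bool}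
    (hh : M.IsParallel h) (hd : M.IsDirection h d) :
    ∃ γ ∈ M.medial.medial.autGroup, M.IsOddShift h γ := by
  obtain ⟨γ, hγ, hs⟩ := exists_shift hh.lift hM.medial.medial (hd.lift hh)
  refine ⟨γ, hγ, fun F => ?_⟩
  rcases hs F with e | e <;> rw [e]
  exacts [isOddShift_step hh F, isOddShift_step_inv hh F]

theorem exists_oddShift_of_step_pow {M : SurfaceMap.{u}} (hM : M.IsSquare) {h : M.Flag → Bool}
    (hh : M.IsParallel h) {n : ℕ} (hn : Odd n) (hs : M.step hh ^ n = 1) :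
    ∃ γ ∈ M.medial.medial.autGroup, M.IsOddShift h γ :=
  ⟨_, step_pow_mem_autGroup hh.lift hM.medial.medial (lift_step_pow hh hs),
    (isOddShift_step hh).pow hn⟩

/-- If `Me(Me(M))` has automorphisms that shift every flag by an odd number of steps
horizontally, and such that shift it vertically, then `Me(Me(M))` and `M` have the same number of
flag orbits. -/
theorem isKOrbit_of_oddShift (M : SurfaceMap.{u}) (k : ℕ) (hk : M.IsKOrbit k) (h : M.Flag → Bool)
    (hX : ∃ γ ∈ M.medial.medial.autGroup, M.IsOddShift h γ)
    (hY : ∃ γ ∈ M.medial.medial.autGroup, M.IsOddShift (fun Φ => !(h Φ)) γ) :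
    M.medial.medial.IsKOrbit k := by
  obtain ⟨X, hX, sX⟩ := hX
  obtain ⟨Y, hY, sY⟩ := hY
  rw [IsOddShift, liftParallel_not] at sY
  beta_reduce at sY
  have hbase : ∀ F, M.medial.kind F = false → M.kind (M.medial.baseFlag F) = false →
      ∃ Ψ, F = M.medialFlag₂ Ψ false false := by
    intro F e₁ e₂
    obtain ⟨Φ, a, b, rfl⟩ := M.medialFlag₂_surj F
    simp only [medialFlag₂, kind_medialFlag, baseFlag_medialFlag] at e₁ e₂
    exact ⟨Φ, by rw [e₁, e₂]⟩
  have hb : ∀ F, M.medial.kind F = true →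
      ∃ Ψ, M.medial.medial.AutRel F (M.medialFlag₂ Ψ false false) := by
    intro F e
    -- `X` adds `liftParallel` to the kind of the base flag and `Y` adds its negation, so exactly
    -- one of them makes that kind `false`.
    by_cases e' : M.kind (M.medial.baseFlag F) = M.liftParallel h F
    · obtain ⟨x1, x2, x3⟩ := sX F
      obtain ⟨Ψ, hΨ⟩ := hbase (X F) (by rw [x1, e]; rfl) (by rw [x3, e', Bool.xor_self])
      exact ⟨Ψ, X, hX, hΨ⟩
    · obtain ⟨y1, y2, y3⟩ := sY F
      obtain ⟨Ψ, hΨ⟩ := hbase (Y F) (by rw [y1, e]; rfl) (by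
        rw [y3]
        revert e'
        cases M.kind (M.medial.baseFlag F) <;> cases M.liftParallel h F <;> simp)
      exact ⟨Ψ, Y, hY, hΨ⟩
  refine M.isKOrbit_medial_medial k hk fun F => ?_
  cases e : M.medial.kind F
  · obtain ⟨Ψ, hΨ⟩ := hb (X F) (by rw [(sX F).1, e]; rfl)
    exact ⟨Ψ, AutRel.trans ⟨X, hX, rfl⟩ hΨ⟩
  · exact hb F e

/-- The theorem for maps of type `{4,4}` with two parallel classes of edges. -/
theorem isKOrbit_of_direction (M : SurfaceMap.{u}) (k : ℕ) (hk : M.IsKOrbit k) (hM : M.IsSquare)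
    {h d : M.Flag → Bool} (hh : M.IsParallel h) (hd : M.IsDirection h d)
    (hv : (∃ d', M.IsDirection (fun Φ => !(h Φ)) d') ∨ ∃ n, Odd n ∧ M.step hh.not ^ n = 1) :
    M.medial.medial.IsKOrbit k := by
  refine M.isKOrbit_of_oddShift k hk h (exists_oddShift_of_direction hM hh hd) ?_
  rcases hv with ⟨d', hd'⟩ | ⟨n, hn, hs⟩
  · exact exists_oddShift_of_direction hM hh.not hd'
  · exact exists_oddShift_of_step_pow hM hh.not hn hs

end SurfaceMap

namespace SurfaceMap

/-! ### Transport along isomorphisms -/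

theorem Iso.isSquare {M : SurfaceMap.{u}} {N : SurfaceMap.{v}} (e : Iso M N) (hN : N.IsSquare) :
    M.IsSquare := by
  constructor <;> intro Φ <;> apply e.toEquiv.injective <;> simp only [e.map_s]
  exacts [hN.face _, hN.vertex _]

theorem Iso.isParallel {M : SurfaceMap.{u}} {N : SurfaceMap.{v}} (e : Iso M N)
    {h : N.Flag → Bool} (hh : N.IsParallel h) : M.IsParallel fun Φ => h (e.toEquiv Φ) := by
  constructor <;> intro Φ <;> simp only [e.map_s]
  exacts [hh.s0 _, hh.s1 _, hh.s2 _]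

theorem Iso.isDirection {M : SurfaceMap.{u}} {N : SurfaceMap.{v}} (e : Iso M N)
    {h d : N.Flag → Bool} (hd : N.IsDirection h d) :
    M.IsDirection (fun Φ => h (e.toEquiv Φ)) fun Φ => d (e.toEquiv Φ) := by
  constructor <;> intro Φ <;> simp only [e.map_s]
  exacts [hd.s0 _, hd.s1 _, hd.s2 _]

theorem Iso.map_step {M : SurfaceMap.{u}} {N : SurfaceMap.{v}} (e : Iso M N)
    {h : N.Flag → Bool} (hh : N.IsParallel h) (Φ : M.Flag) :
    e.toEquiv (M.step (e.isParallel hh) Φ) = N.step hh (e.toEquiv Φ) := by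
  cases e' : h (e.toEquiv Φ)
  · rw [step_of_false (e.isParallel hh) e', step_of_false hh e']
    simp only [e.map_s]
  · rw [step_of_true (e.isParallel hh) e', step_of_true hh e']
    simp only [e.map_s]

theorem Iso.map_step_pow {M : SurfaceMap.{u}} {N : SurfaceMap.{v}} (e : Iso M N)
    {h : N.Flag → Bool} (hh : N.IsParallel h) (n : ℕ) (Φ : M.Flag) :
    e.toEquiv ((M.step (e.isParallel hh) ^ n) Φ) = (N.step hh ^ n) (e.toEquiv Φ) := by
  induction n with
  | zero => rfl
  | succ n ih => rw [pow_succ', pow_succ', Equiv.Perm.mul_apply, Equiv.Perm.mul_apply,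
      e.map_step, ih]

theorem Iso.step_pow_eq_one {M : SurfaceMap.{u}} {N : SurfaceMap.{v}} (e : Iso M N)
    {h : N.Flag → Bool} (hh : N.IsParallel h) {n : ℕ} (hn : N.step hh ^ n = 1) :
    M.step (e.isParallel hh) ^ n = 1 := by
  ext Φ
  apply e.toEquiv.injective
  rw [e.map_step_pow hh, hn]
  rfl

end SurfaceMap

/-! ### The Klein bottle maps -/

namespace SquareFlag

open SurfaceMap

/-- The class of a flag of the square tessellation in the Klein bottle map. -/
def kleinMk (m n : ℕ+) (F : SquareFlag) : (klein44 m n).Flag :=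
  (Quotient.mk'' F : KleinFlag m n)

theorem kleinMk_surj {m n : ℕ+} (q : (klein44 m n).Flag) : ∃ F, q = kleinMk m n F := by
  obtain ⟨F, hF⟩ := Quotient.exists_rep (s := MulAction.orbitRel (kleinGroup m n) SquareFlag) q
  exact ⟨F, hF.symm⟩

theorem klein_s (m n : ℕ+) (i : Fin 3) (F : SquareFlag) :
    (klein44 m n).s i (kleinMk m n F) = kleinMk m n (adj i F) := rfl

theorem kleinMk_eq_of_mem {m n : ℕ+} {g : Equiv.Perm SquareFlag} (hg : g ∈ kleinGroup m n)
    (F : SquareFlag) : kleinMk m n (g F) = kleinMk m n F :=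
  kleinFlag_eq_iff.2 ⟨g, hg, rfl⟩

/-- Horizontal edges of the Klein bottle map. -/
def kleinHoriz (m n : ℕ+) : (klein44 m n).Flag → Bool :=
  Quotient.lift (s := MulAction.orbitRel (kleinGroup m n) SquareFlag) SquareFlag.horiz (by
    rintro F _ ⟨g, rfl⟩
    obtain ⟨i, hi⟩ := kleinGroup_form g.2
    exact (hi _).2.1)

/-- The horizontal direction of a flag of the Klein bottle map. -/
def kleinDir (m n : ℕ+) : (klein44 m n).Flag → Bool :=
  Quotient.lift (s := MulAction.orbitRel (kleinGroup m n) SquareFlag)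
    (fun F => decide (F.σ = 1)) (by
    rintro F _ ⟨g, rfl⟩
    obtain ⟨i, hi⟩ := kleinGroup_form g.2
    exact congrArg (fun s => decide (s = 1)) (hi _).2.2.1)

theorem kleinHoriz_mk (m n : ℕ+) (F : SquareFlag) : kleinHoriz m n (kleinMk m n F) = F.horiz := rfl

theorem kleinDir_mk (m n : ℕ+) (F : SquareFlag) :
    kleinDir m n (kleinMk m n F) = decide (F.σ = 1) := rfl

theorem klein_isSquare (m n : ℕ+) : (klein44 m n).IsSquare := by
  constructor <;> intro q <;> obtain ⟨⟨x, y, b, σ, τ⟩, rfl⟩ := kleinMk_surj q <;>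
    simp only [klein_s] <;> congr 1 <;> cases b <;> simp [adj]

theorem klein_isParallel (m n : ℕ+) : (klein44 m n).IsParallel (kleinHoriz m n) := by
  constructor <;> intro q <;> obtain ⟨⟨x, y, b, σ, τ⟩, rfl⟩ := kleinMk_surj q <;>
    cases b <;> rfl

/-- Both generators of `kleinGroup` fix `σ`. The glide reflection negates `τ`, so `klein_step_pow`
takes the place of a vertical direction. -/
theorem klein_isDirection (m n : ℕ+) :
    (klein44 m n).IsDirection (kleinHoriz m n) (kleinDir m n) := by
  constructor <;> intro q <;> obtain ⟨⟨x, y, b, σ, τ⟩, rfl⟩ := kleinMk_surj q <;>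
    simp only [klein_s, kleinHoriz_mk, kleinDir_mk] <;> cases b <;>
    rcases Int.units_eq_one_or σ with rfl | rfl <;> simp [adj]

theorem klein_step (m n : ℕ+) (x y : ℤ) (b : Bool) (σ τ : ℤˣ) :
    (klein44 m n).step (klein_isParallel m n).not (kleinMk m n ⟨x, y, b, σ, τ⟩) =
      kleinMk m n ⟨x, y + τ, b, σ, τ⟩ := by
  cases b
  · rw [step_of_true _ rfl]
    simp [klein_s, adj]
  · rw [step_of_false _ rfl]
    simp [klein_s, adj]

theorem klein_step_pow (m n : ℕ+) : (klein44 m n).step (klein_isParallel m n).not ^ (n : ℕ) = 1 := by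
  have key : ∀ (k : ℕ) (x y : ℤ) (b : Bool) (σ τ : ℤˣ),
      ((klein44 m n).step (klein_isParallel m n).not ^ k) (kleinMk m n ⟨x, y, b, σ, τ⟩) =
        kleinMk m n ⟨x, y + k * τ, b, σ, τ⟩ := by
    intro k
    induction k with
    | zero => intro x y b σ τ; simp
    | succ k ih =>
      intro x y b σ τ
      rw [pow_succ', Equiv.Perm.mul_apply, ih, klein_step]
      congr 2
      push_cast
      ring
  have hT : vtrans n ∈ kleinGroup m n := Subgroup.subset_closure (by simp)
  ext q
  obtain ⟨⟨x, y, b, σ, τ⟩, rfl⟩ := kleinMk_surj q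
  rw [key]
  -- Upward flags have moved by the translation through `n`, downward ones by its inverse.
  rcases Int.units_eq_one_or τ with rfl | rfl
  · refine Eq.trans ?_ (kleinMk_eq_of_mem hT _)
    simp [vtrans]
  · refine Eq.trans ?_ (kleinMk_eq_of_mem (inv_mem hT) _)
    change _ = kleinMk m n ⟨x, y - n, b, σ, -1⟩
    congr 2
    simp [sub_eq_add_neg]

end SquareFlag

theorem SurfaceMap.isKOrbit_medial_medial_of_klein (M : SurfaceMap.{u}) (k : ℕ) (hk : M.IsKOrbit k)
    (m n : ℕ+) (hn : Odd (n : ℕ)) (e : SurfaceMap.Iso M (klein44 m n)) :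
    M.medial.medial.IsKOrbit k :=
  M.isKOrbit_of_direction k hk (e.isSquare (SquareFlag.klein_isSquare m n))
    (e.isParallel (SquareFlag.klein_isParallel m n))
    (e.isDirection (SquareFlag.klein_isDirection m n))
    (Or.inr ⟨n, hn, e.step_pow_eq_one (SquareFlag.klein_isParallel m n).not
      (SquareFlag.klein_step_pow m n)⟩)

namespace SurfaceMap

/-! ### Maps of type `{4,4}` on the torus -/

/-- In an orientable map, half of the flags of a cell are images of each other under rotations
about its centre. -/
theorem minimalPeriod_rotation (M : SurfaceMap.{u}) (hM : M.IsOrientable) {i j l : Fin 3}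
    (hij : ({i, j} : Set (Fin 3)) = {x | x ≠ l}) (Φ : M.Flag) :
    (MulAction.orbit (M.cellGroup l) Φ).ncard =
      2 * Function.minimalPeriod (fun X => M.s i (M.s j X)) Φ := by
  obtain ⟨c, hc⟩ := hM
  have := M.finite_flag
  set r := M.s i * M.s j with hr
  have hi : M.s i ∈ M.cellGroup l := Subgroup.subset_closure ⟨i, by rw [← hij]; simp, rfl⟩
  have hj : M.s j ∈ M.cellGroup l := Subgroup.subset_closure ⟨j, by rw [← hij]; simp, rfl⟩
  have hrm : r ∈ M.cellGroup l := mul_mem hi hj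
  set A := MulAction.orbit (Subgroup.zpowers r) Φ with hA
  have memA : ∀ X, X ∈ A ↔ ∃ z : ℤ, (r ^ z) Φ = X := by
    intro X
    rw [hA, MulAction.mem_orbit_iff]
    constructor
    · rintro ⟨⟨_, z, rfl⟩, h⟩
      exact ⟨z, h⟩
    · rintro ⟨z, h⟩
      exact ⟨⟨_, z, rfl⟩, h⟩
  have hrA : ∀ X ∈ A, r X ∈ A := by
    intro X hX
    obtain ⟨z, rfl⟩ := (memA X).1 hX
    exact (memA _).2 ⟨1 + z, by rw [zpow_add, zpow_one]; rfl⟩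
  have hrA' : ∀ X ∈ A, M.s j (M.s i X) ∈ A := by
    intro X hX
    obtain ⟨z, rfl⟩ := (memA X).1 hX
    refine (memA _).2 ⟨-1 + z, ?_⟩
    rw [zpow_add, zpow_neg_one, Equiv.Perm.mul_apply, Equiv.Perm.inv_eq_iff_eq]
    simp [hr, M.s_invol]
  have hstep : ∀ t ∈ ({i, j} : Set (Fin 3)), ∀ X ∈ A ∪ M.s i '' A, M.s t X ∈ A ∪ M.s i '' A := by
    rintro t (rfl | rfl) X (hX | ⟨Y, hY, rfl⟩)
    · exact Or.inr ⟨X, hX, rfl⟩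
    · exact Or.inl (by rwa [M.s_invol])
    · exact Or.inr ⟨r X, hrA X hX, by simp [hr, M.s_invol]⟩
    · exact Or.inl (hrA' Y hY)
  have horb : MulAction.orbit (M.cellGroup l) Φ = A ∪ M.s i '' A := by
    apply Set.Subset.antisymm
    · rintro _ ⟨⟨w, hw⟩, rfl⟩
      have key : ∀ X, X ∈ A ∪ M.s i '' A ↔ w X ∈ A ∪ M.s i '' A := by
        rw [cellGroup, ← hij] at hw
        induction hw using Subgroup.closure_induction with
        | mem x hx =>
          obtain ⟨t, ht, rfl⟩ := hx
          refine fun X => ⟨hstep t ht X, fun h => ?_⟩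
          simpa only [M.s_invol] using hstep t ht _ h
        | one => exact fun _ => Iff.rfl
        | mul a b _ _ ha hb => exact fun X => (hb X).trans (ha (b X))
        | inv a _ ha =>
          intro X
          rw [ha (a⁻¹ X), perm_apply_inv]
      exact (key Φ).1 (Or.inl (MulAction.mem_orbit_self Φ))
    · rintro X (hX | ⟨Y, hY, rfl⟩)
      · obtain ⟨z, rfl⟩ := (memA X).1 hX
        exact ⟨⟨r ^ z, zpow_mem hrm z⟩, rfl⟩
      · obtain ⟨z, rfl⟩ := (memA Y).1 hY
        exact ⟨⟨M.s i * r ^ z, mul_mem hi (zpow_mem hrm z)⟩, rfl⟩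
  -- A rotation is a product of two adjacencies and keeps the colour, while `s i` changes it; this
  -- separates the two halves of the orbit.
  have hcA : ∀ X ∈ A, c X = c Φ := by
    have hcr : ∀ X, c (r X) = c X := fun X => by simp [hr, hc]
    intro X hX
    obtain ⟨z, rfl⟩ := (memA X).1 hX
    clear hX
    induction z using Int.induction_on with
    | zero => rfl
    | succ z ih => rw [add_comm, zpow_add, zpow_one, Equiv.Perm.mul_apply, hcr, ih]
    | pred z ih =>
      rw [← ih, ← hcr, ← Equiv.Perm.mul_apply, ← zpow_one_add]
      congr 3
      ring
  have hdisj : Disjoint A (M.s i '' A) := by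
    rw [Set.disjoint_left]
    rintro X hX ⟨Y, hY, rfl⟩
    have h1 := hcA _ hX
    rw [hc, hcA Y hY] at h1
    simp at h1
  have hcard : Function.minimalPeriod (fun X => M.s i (M.s j X)) Φ = A.ncard := by
    have := Fintype.ofFinite A
    have h := MulAction.minimalPeriod_eq_card (a := r) (b := Φ)
    rw [← Nat.card_coe_set_eq, Nat.card_eq_fintype_card]
    exact h
  rw [horb, Set.ncard_union_eq hdisj, Set.ncard_image_of_injective _ (M.s i).injective, hcard,
    two_mul]

/-- The rotation has period exactly 4: its fourth power gives the relation, and its square fixes no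
flag. -/
theorem rotation_of_ncard (M : SurfaceMap.{u}) (hM : M.IsOrientable) {i j l : Fin 3}
    (hij : ({i, j} : Set (Fin 3)) = {x | x ≠ l})
    (h : ∀ Φ : M.Flag, (MulAction.orbit (M.cellGroup l) Φ).ncard = 2 * 4) (Φ : M.Flag) :
    M.s i (M.s j (M.s i (M.s j Φ))) = M.s j (M.s i (M.s j (M.s i Φ))) ∧
      M.s i (M.s j (M.s i (M.s j Φ))) ≠ Φ := by
  have h4 : Function.minimalPeriod (fun X => M.s i (M.s j X)) Φ = 4 := by
    have := (M.minimalPeriod_rotation hM hij Φ).symm.trans (h Φ)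
    omega
  constructor
  · have hp := Function.isPeriodicPt_minimalPeriod (fun X => M.s i (M.s j X)) Φ
    rw [h4] at hp
    have hp' : M.s i (M.s j (M.s i (M.s j (M.s i (M.s j (M.s i (M.s j Φ))))))) = Φ := hp
    conv_rhs => rw [← hp']
    simp only [M.s_invol]
  · intro hp
    have hp' : Function.IsPeriodicPt (fun X => M.s i (M.s j X)) 2 Φ := hp
    have := hp'.minimalPeriod_le (by norm_num)
    omega

/-! ### The covering of a map of type {4,4} by the square tessellation -/

section cover

variable (M : SurfaceMap.{u})

/-- The horizontal translation of the standard flag of the tessellation, as a monodromy. -/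
def right : Equiv.Perm M.Flag := M.s 1 * M.s 2 * M.s 1 * M.s 0

/-- The vertical translation of the standard flag of the tessellation, as a monodromy. -/
def up : Equiv.Perm M.Flag := M.s 2 * M.s 1 * M.s 0 * M.s 1

variable {M}

theorem right_apply (Φ : M.Flag) : M.right Φ = M.s 1 (M.s 2 (M.s 1 (M.s 0 Φ))) := rfl

theorem up_apply (Φ : M.Flag) : M.up Φ = M.s 2 (M.s 1 (M.s 0 (M.s 1 Φ))) := rfl

theorem commute_right_up (hM : M.IsSquare) : Commute M.right M.up := by
  ext Φ
  simp only [Equiv.Perm.mul_apply, right_apply, up_apply, M.s_invol]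
  rw [M.s_comm, ← hM.vertex, hM.face, M.s_invol, M.s_comm]

/-- The image of the standard flag at `(x, y)` under the covering of `M` by the tessellation. -/
def coverPoint (Φ : M.Flag) (x y : ℤ) : M.Flag := (M.right ^ x) ((M.up ^ y) Φ)

theorem coverPoint_right (Φ : M.Flag) (x y : ℤ) :
    coverPoint Φ (x + 1) y = M.s 1 (M.s 2 (M.s 1 (M.s 0 (coverPoint Φ x y)))) := by
  rw [coverPoint, add_comm, zpow_add, zpow_one]
  rfl

theorem coverPoint_up (hM : M.IsSquare) (Φ : M.Flag) (x y : ℤ) :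
    coverPoint Φ x (y + 1) = M.s 2 (M.s 1 (M.s 0 (M.s 1 (coverPoint Φ x y)))) := by
  rw [coverPoint, add_comm, zpow_add, zpow_one, ← Equiv.Perm.mul_apply, ← mul_assoc,
    ((commute_right_up hM).zpow_left x).eq]
  rfl

/-- The covering of `M` by the square tessellation. -/
def cover (Φ : M.Flag) (F : SquareFlag) : M.Flag :=
  let P := coverPoint Φ F.x F.y
  -- On a horizontal flag `s 2` reverses `τ`, and `s 1 s 2 s 1` reverses `σ`.
  let Q := if F.τ = 1 then P else M.s 2 P
  let R := if F.σ = 1 then Q else M.s 1 (M.s 2 (M.s 1 Q))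
  bif F.horiz then R else M.s 1 R

theorem cover_adj (hM : M.IsSquare) (Φ : M.Flag) (i : Fin 3) (F : SquareFlag) :
    cover Φ (SquareFlag.adj i F) = M.s i (cover Φ F) := by
  have hr := coverPoint_right Φ
  have hr' : ∀ x y, coverPoint Φ x y =
      M.s 1 (M.s 2 (M.s 1 (M.s 0 (coverPoint Φ (x + -1) y)))) := fun x y => by
    rw [← hr, neg_add_cancel_right]
  have hu := coverPoint_up hM Φ
  have hu' : ∀ x y, coverPoint Φ x y =
      M.s 2 (M.s 1 (M.s 0 (M.s 1 (coverPoint Φ x (y + -1))))) := fun x y => by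
    rw [← hu, neg_add_cancel_right]
  have hv := hM.vertex
  have hf := hM.face
  have hc := M.s_comm
  have hi := M.s_invol
  obtain ⟨x, y, b, σ, τ⟩ := F
  -- These serve the backward moves: for `i = 0` and sign `-1`, the point at `(x, y)` is rewritten
  -- from its left or lower neighbour.
  have hrx := hr' x y
  have huy := hu' x y
  have hneg : (-1 : ℤˣ) ≠ 1 := by decide
  rcases Int.units_eq_one_or σ with rfl | rfl <;> rcases Int.units_eq_one_or τ with rfl | rfl <;>
    fin_cases i <;> cases b <;>
    simp only [Fin.zero_eta, Fin.mk_one, Fin.reduceFinMk, cover, SquareFlag.adj, if_true, if_false,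
      cond_true, cond_false, neg_neg, hneg, Units.val_one, Units.val_neg, Bool.not_true,
      Bool.not_false, hi, hr, hu]
  · rw [huy]; simp only [hi]
  · simp only [hv, hi, hc]
  · rw [hc]
  · rw [hrx]; simp only [hi]
  · rw [hv]
  · rw [huy]; simp only [hi, hc]
  · rw [← hv, hrx]; simp only [hi, hc]
  · simp only [hv, hi]

theorem cover_surj (hM : M.IsSquare) (Φ Ψ : M.Flag) : ∃ F, cover Φ F = Ψ := by
  refine M.forall_of_s_invariant (fun X => ∃ F, cover Φ F = X) ?_
    (Φ := cover Φ ⟨0, 0, true, 1, 1⟩) ⟨_, rfl⟩ Ψ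
  rintro i _ ⟨F, rfl⟩
  exact ⟨SquareFlag.adj i F, cover_adj hM Φ i F⟩

/-- A symmetry of the tessellation that identifies two flags with the same image is a deck
transformation. -/
theorem cover_deck (hM : M.IsSquare) (Φ : M.Flag) (g : SquareFlag → SquareFlag)
    (hg : ∀ i F, g (SquareFlag.adj i F) = SquareFlag.adj i (g F)) {F : SquareFlag}
    (hF : cover Φ (g F) = cover Φ F) (F' : SquareFlag) : cover Φ (g F') = cover Φ F' := by
  refine SquareFlag.reach (fun X => cover Φ (g X) = cover Φ X) ?_ F F' hF
  intro i X
  rw [hg, cover_adj hM, cover_adj hM, (M.s i).apply_eq_iff_eq]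

/-- The rotation by a half turn `(x, y) ↦ (a - x, b - y)`. -/
def halfTurn (a b : ℤ) (F : SquareFlag) : SquareFlag :=
  ⟨a - F.x, b - F.y, F.horiz, -F.σ, -F.τ⟩

/-- The rotation by a quarter turn `(x, y) ↦ (a - y, b + x)`. -/
def quarterTurn (a b : ℤ) (F : SquareFlag) : SquareFlag :=
  ⟨a - F.y, b + F.x, !F.horiz, -F.τ, F.σ⟩

theorem halfTurn_adj (a b : ℤ) (i : Fin 3) (F : SquareFlag) :
    halfTurn a b (SquareFlag.adj i F) = SquareFlag.adj i (halfTurn a b F) := by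
  obtain ⟨x, y, h, σ, τ⟩ := F
  fin_cases i <;> cases h <;> simp [halfTurn, SquareFlag.adj] <;> ring

theorem quarterTurn_adj (a b : ℤ) (i : Fin 3) (F : SquareFlag) :
    quarterTurn a b (SquareFlag.adj i F) = SquareFlag.adj i (quarterTurn a b F) := by
  obtain ⟨x, y, h, σ, τ⟩ := F
  fin_cases i <;> cases h <;> simp [quarterTurn, SquareFlag.adj] <;> ring

theorem quarterTurn_quarterTurn (a b : ℤ) (F : SquareFlag) :
    quarterTurn a b (quarterTurn a b F) = halfTurn (a - b) (b + a) F := by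
  ext <;> simp [quarterTurn, halfTurn] <;> ring

/-- A half turn is not a deck transformation: its centre is the centre of a vertex, edge or face,
whose flags have distinct images. -/
theorem cover_halfTurn_ne (hM : M.IsSquare)
    (hf : ∀ Φ, M.s 0 (M.s 1 (M.s 0 (M.s 1 Φ))) ≠ Φ)
    (hv : ∀ Φ, M.s 2 (M.s 1 (M.s 2 (M.s 1 Φ))) ≠ Φ)
    (Φ : M.Flag) (a b : ℤ) (F : SquareFlag) : cover Φ (halfTurn a b F) ≠ cover Φ F := by
  intro hF
  have h := cover_deck hM Φ _ (halfTurn_adj a b) hF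
  -- The centre `(a/2, b/2)` is a vertex, the midpoint of a vertical or horizontal edge, or the
  -- centre of a face, according to the parities.
  rcases Int.even_or_odd' a with ⟨p, rfl | rfl⟩ <;> rcases Int.even_or_odd' b with ⟨q, rfl | rfl⟩
  · refine hv (cover Φ ⟨p, q, true, 1, 1⟩) (Eq.trans ?_ (h _))
    simp only [← cover_adj hM]
    congr 1
    ext <;> simp [halfTurn, SquareFlag.adj]
    all_goals ring
  · refine M.s_comm_free (cover Φ ⟨p, q, false, 1, 1⟩) (Eq.trans ?_ (h _))
    simp only [← cover_adj hM]
    congr 1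
    ext <;> simp [halfTurn, SquareFlag.adj]
    all_goals ring
  · refine M.s_comm_free (cover Φ ⟨p, q, true, 1, 1⟩) (Eq.trans ?_ (h _))
    simp only [← cover_adj hM]
    congr 1
    ext <;> simp [halfTurn, SquareFlag.adj]
    all_goals ring
  · refine hf (cover Φ ⟨p, q, true, 1, 1⟩) (Eq.trans ?_ (h _))
    simp only [← cover_adj hM]
    congr 1
    ext <;> simp [halfTurn, SquareFlag.adj]
    all_goals ring

/-- A quarter turn among the deck transformations would have a half turn as its square. -/
theorem cover_quarterTurn_ne (hM : M.IsSquare)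
    (hf : ∀ Φ, M.s 0 (M.s 1 (M.s 0 (M.s 1 Φ))) ≠ Φ)
    (hv : ∀ Φ, M.s 2 (M.s 1 (M.s 2 (M.s 1 Φ))) ≠ Φ)
    (Φ : M.Flag) (a b : ℤ) (F : SquareFlag) : cover Φ (quarterTurn a b F) ≠ cover Φ F := by
  intro hF
  refine cover_halfTurn_ne hM hf hv Φ (a - b) (b + a) F ?_
  rw [← quarterTurn_quarterTurn, cover_deck hM Φ _ (quarterTurn_adj a b) hF, hF]

/-- The orientation of a flag of the tessellation. -/
def squareSign (F : SquareFlag) : Bool := xor F.horiz (xor (decide (F.σ = 1)) (decide (F.τ = 1)))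

theorem squareSign_adj (i : Fin 3) (F : SquareFlag) :
    squareSign (SquareFlag.adj i F) = !(squareSign F) := by
  obtain ⟨x, y, h, σ, τ⟩ := F
  rcases Int.units_eq_one_or σ with rfl | rfl <;> rcases Int.units_eq_one_or τ with rfl | rfl <;>
    fin_cases i <;> cases h <;> rfl

theorem squareSign_eq_of_cover_eq (hM : M.IsSquare) (ho : M.IsOrientable) (Φ : M.Flag)
    {F F' : SquareFlag} (hF : cover Φ F = cover Φ F') : squareSign F = squareSign F' := by
  obtain ⟨c, hc⟩ := ho
  have h := SquareFlag.reach
    (fun X => xor (c (cover Φ X)) (squareSign X) = xor (c (cover Φ F)) (squareSign F))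
    (fun i X => by rw [cover_adj hM, hc, squareSign_adj]; simp) F F' rfl
  simp only [hF] at h
  exact (Bool.xor_right_inj.1 h).symm

/-- On the torus, flags of the tessellation with the same image are translates of each other. -/
theorem translate_of_cover_eq (hM : M.IsSquare) (ho : M.IsOrientable)
    (hf : ∀ Φ, M.s 0 (M.s 1 (M.s 0 (M.s 1 Φ))) ≠ Φ)
    (hv : ∀ Φ, M.s 2 (M.s 1 (M.s 2 (M.s 1 Φ))) ≠ Φ)
    (Φ : M.Flag) {F F' : SquareFlag} (hF : cover Φ F = cover Φ F') :
    F.horiz = F'.horiz ∧ F.σ = F'.σ ∧ F.τ = F'.τ := by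
  have hsign := squareSign_eq_of_cover_eq hM ho Φ hF
  have half : ∀ {F F' : SquareFlag}, cover Φ F = cover Φ F' → F.horiz = F'.horiz → F.σ = -F'.σ →
      F.τ = -F'.τ → False := by
    intro F F' e h1 h2 h3
    refine cover_halfTurn_ne hM hf hv Φ (F.x + F'.x) (F.y + F'.y) F' (Eq.trans ?_ e)
    congr 1
    ext <;> simp [halfTurn, h1, h2, h3]
  have quarter : ∀ {F F' : SquareFlag}, cover Φ F = cover Φ F' → F.horiz = (!F'.horiz) →
      F.σ = -F'.τ → F.τ = F'.σ → False := by
    intro F F' e h1 h2 h3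
    refine cover_quarterTurn_ne hM hf hv Φ (F.x + F'.y) (F.y - F'.x) F' (Eq.trans ?_ e)
    congr 1
    ext <;> simp [quarterTurn, h1, h2, h3]
  have hhalf := half hF
  have hq := quarter hF
  -- The swapped roles exclude the inverse quarter turn; equal signs have already excluded
  -- reflections.
  have hq' := quarter hF.symm
  obtain ⟨x, y, h, σ, τ⟩ := F
  obtain ⟨x', y', h', σ', τ'⟩ := F'
  clear half quarter hF
  simp only at hhalf hq hq' ⊢
  revert hhalf hq hq' hsign
  rcases Int.units_eq_one_or σ with rfl | rfl <;> rcases Int.units_eq_one_or τ with rfl | rfl <;>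
    rcases Int.units_eq_one_or σ' with rfl | rfl <;>
    rcases Int.units_eq_one_or τ' with rfl | rfl <;>
    cases h <;> cases h' <;> simp [squareSign]

end cover

theorem isKOrbit_medial_medial_of_torus (M : SurfaceMap.{u}) (k : ℕ) (hk : M.IsKOrbit k)
    (ho : M.IsOrientable) (ht : M.HasSchlafliType 4 4) : M.medial.medial.IsKOrbit k := by
  have hface := M.rotation_of_ncard ho (i := 0) (j := 1) (l := 2)
    (by ext x; fin_cases x <;> simp) ht.1
  have hvert := M.rotation_of_ncard ho (i := 2) (j := 1) (l := 0)
    (by ext x; fin_cases x <;> simp) ht.2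
  have hM : M.IsSquare := ⟨fun Φ => (hface Φ).1, fun Φ => (hvert Φ).1⟩
  obtain ⟨Φ⟩ := M.nonempty_flag
  -- The lifts are arbitrary: by `translate_of_cover_eq`, `horiz`, `σ` and `τ` do not depend on the
  -- choice.
  choose f hf using cover_surj hM Φ
  have hfs : ∀ i X, (f (M.s i X)).horiz = (SquareFlag.adj i (f X)).horiz ∧
      (f (M.s i X)).σ = (SquareFlag.adj i (f X)).σ ∧
      (f (M.s i X)).τ = (SquareFlag.adj i (f X)).τ := fun i X =>
    translate_of_cover_eq hM ho (fun Ψ => (hface Ψ).2) (fun Ψ => (hvert Ψ).2) Φ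
      (by rw [hf, cover_adj hM, hf])
  have hp : M.IsParallel fun X => (f X).horiz := by
    constructor <;> intro X <;> simp only [(hfs _ X).1] <;>
      obtain ⟨x, y, h, σ, τ⟩ := f X <;> cases h <;> rfl
  have hd : M.IsDirection (fun X => (f X).horiz) fun X => decide ((f X).σ = 1) := by
    constructor <;> intro X <;> simp only [(hfs _ X).2.1] <;>
      obtain ⟨x, y, h, σ, τ⟩ := f X <;> rcases Int.units_eq_one_or σ with rfl | rfl <;>
      cases h <;> rfl
  have hd' : M.IsDirection (fun X => !(f X).horiz) fun X => decide ((f X).τ = 1) := by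
    constructor <;> intro X <;> simp only [(hfs _ X).2.2] <;>
      obtain ⟨x, y, h, σ, τ⟩ := f X <;> rcases Int.units_eq_one_or τ with rfl | rfl <;>
      cases h <;> rfl
  exact M.isKOrbit_of_direction k hk hM hp hd (Or.inl ⟨_, hd'⟩)

end SurfaceMap

theorem mainTheorem8 (M : SurfaceMap.{u}) (k : ℕ) (hk : M.IsKOrbit k)
    (hM : (M.IsOnTorus ∧ M.HasSchlafliType 4 4) ∨
      ∃ m n : ℕ+, Odd (n : ℕ) ∧ Nonempty (SurfaceMap.Iso M (klein44 m n))) :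
    M.medial.medial.IsKOrbit k := by
  rcases hM with ⟨hM, ht⟩ | ⟨m, n, hn, ⟨e⟩⟩
  · exact M.isKOrbit_medial_medial_of_torus k hk hM.1 ht
  · exact M.isKOrbit_medial_medial_of_klein k hk m n hn e
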